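/- Let $p$ be a prime and let $K$ be a field of characteristic $0$, complete with respect to an ultrametric absolute value with $|p|<1$. Let $\varphi:K\to K$ be an absolute Frobenius, i.e. a ring endomorphism with $|\varphi(x)-x^p|<1$ whenever $|x|\le 1$. Let $B=\mathcal H^\dagger_K$ be the ring of Laurent series $\sum_{k\in\mathbb Z}a_kT^k$ over $K$ converging on some annulus $1-\varepsilon<|T|<1+\varepsilon$, $\varepsilon>0$, with $\sigma_g(f)(T)=f(gT)$ for $g\in D:=\{g\in K: |g-1|<1\}$ and $\phi(\sum_k a_kT^k)=\sum_k\varphi(a_k)T^{pk}$. For a subgroup $G\subseteq D$, a $\sigma$-module over $G$ is a free $B$-module $M$ of finite rank with an action $g\mapsto\sigma^M_g$ of $G$ such that $\sigma^M_g(fm)=\sigma_g(f)\sigma^M_g(m)$; a $\sigma_g$-module is a $\sigma$-module over $g^{\mathbb Z}$. Write $\sigma_g^M(e_i)=\sum_j A(g,T)_{ij}e_j$ in a basis $e$ of $M$. The module $M$ is called solvable if there is a matrix $Y(x,y)=\sum_{m\ge0}F_m(y)(x-y)^m$ with $Y(y,y)=\mathrm{Id}$, where the entries of $F_m$ are analytic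 elements on $|T|=1$ (Laurent series with coefficients tending to $0$ at $\pm\infty$) and $\liminf_m\|F_m\|^{-1/m}\ge 1$ for the sup norm on $|T|=1$, such that $Y(gx,y)=A(g,x)Y(x,y)$ for all $g\in G$ and all $x,y$ with $|x|=|y|=1$, $|x-y|<1$. Let $q\in D$ be not a root of unity, and let $M$ be a solvable $\sigma_q$-module over $B$. Then: (1) The action $\sigma^M$ of $q^{\mathbb Z}$ on $M$ extends in exactly one way to an action of $D$ making $M$ a solvable $\sigma$-module over $D$. For $q'\in D$ let $\mathrm{Def}^{\mathrm{Tay}}_{q,q'}(M)$ be the module $M$ with the operator $\sigma^M_{q'}$ of this extension. (2) Suppose that $M$ has a Frobenius structure: for some $h\ge1$ there are $q'\in D$ with $\varphi^h(q')=q^{p^h}$ and a $B$-linear isomorphism $(\phi^*)^hM=M\otimes_{B,\phi^h}B\to M$ transforming $\sigma^M_{q'}\otimes\sigma_q$ into $\sigma^M_q$ (if $\varphi(q)=q$, then $q'=q^{p^h}$ and $\sigma^M_{q'}=(\sigma_q^M)^{p^h}$). Then for every $n\ge0$ and every $\xi\in K$ with $\xi^{p^n}=1$, the $\sigma_\xi$-module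 $\mathrm{Def}^{\mathrm{Tay}}_{q,\xi}(M)$ is trivial, i.e. isomorphic to a direct sum of copies of the unit object $(B,\sigma_\xi)$. -/

import Mathlib

open Filter Topology

set_option linter.unusedSectionVars false

/-- A two-sided sequence of coefficients `a : ℤ → K` such that the Laurent series
`∑ a_k T^k` converges on an annulus `1 - ε < |T| < 1 + ε` for some `ε > 0`. -/
def IsOverconvergent {K : Type*} [NormedField K] (a : ℤ → K) : Prop :=
  ∃ ρ : ℝ, 1 < ρ ∧ ∃ C : ℝ, ∀ k : ℤ, ‖a k‖ ≤ C * (ρ ^ k.natAbs)⁻¹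

/-- The ring `H†_K` of overconvergent analytic functions on the circle `|T| = 1`: the Laurent
series `∑ a_k T^k` over `K` that converge on some annulus `1 - ε < |T| < 1 + ε`. -/
@[ext]
structure HDagger (K : Type*) [NormedField K] where
  coeff : ℤ → K
  overconvergent : IsOverconvergent coeff

namespace HDagger

section Ring

variable {K : Type*} [NormedField K]

theorem summable_inv_pow {ρ : ℝ} (hρ : 1 < ρ) :
    Summable fun i : ℤ => (ρ ^ i.natAbs)⁻¹ := by
  have h : Summable fun n : ℕ => (ρ ^ n)⁻¹ := by
    simpa [inv_pow] using
      summable_geometric_of_lt_one (inv_nonneg.2 (by linarith)) (inv_lt_one_of_one_lt₀ hρ)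
  exact Summable.of_nat_of_neg (by simpa using h) (by simpa using h)

theorem isOverconvergent_mono {a : ℤ → K} {ρ C : ℝ}
    (h : ∀ k : ℤ, ‖a k‖ ≤ C * (ρ ^ k.natAbs)⁻¹) {s : ℝ} (hs : 1 < s) (hsρ : s ≤ ρ) :
    ∀ k : ℤ, ‖a k‖ ≤ C * (s ^ k.natAbs)⁻¹ := by
  intro k
  have hC : 0 ≤ C := by
    have h0 := h 0
    simp only [Int.natAbs_zero, pow_zero, inv_one, mul_one] at h0
    exact (norm_nonneg _).trans h0
  refine (h k).trans (mul_le_mul_of_nonneg_left ?_ hC)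
  exact inv_anti₀ (pow_pos (by linarith) _) (pow_le_pow_left₀ (by linarith) hsρ _)

/-- Two overconvergent series satisfy bounds with the same radius and the same constant. -/
theorem common_bound {a b : ℤ → K} (ha : IsOverconvergent a) (hb : IsOverconvergent b) :
    ∃ ρ : ℝ, 1 < ρ ∧ ∃ C : ℝ, 0 ≤ C ∧ (∀ k : ℤ, ‖a k‖ ≤ C * (ρ ^ k.natAbs)⁻¹) ∧
      ∀ k : ℤ, ‖b k‖ ≤ C * (ρ ^ k.natAbs)⁻¹ := by
  obtain ⟨ρ, hρ, C, hC⟩ := ha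
  obtain ⟨ρ', hρ', C', hC'⟩ := hb
  have hm : 1 < min ρ ρ' := lt_min hρ hρ'
  have h1 := isOverconvergent_mono hC hm (min_le_left _ _)
  have h2 := isOverconvergent_mono hC' hm (min_le_right _ _)
  have hp : ∀ k : ℤ, 0 ≤ ((min ρ ρ') ^ k.natAbs)⁻¹ := fun k =>
    inv_nonneg.2 (pow_nonneg (by linarith) _)
  refine ⟨min ρ ρ', hm, max (max C C') 0, le_max_right _ _, fun k => (h1 k).trans ?_,
    fun k => (h2 k).trans ?_⟩
  · exact mul_le_mul_of_nonneg_right ((le_max_left _ _).trans (le_max_left _ _)) (hp k)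
  · exact mul_le_mul_of_nonneg_right ((le_max_right _ _).trans (le_max_left _ _)) (hp k)

/-- The coefficients of the product of two Laurent series. -/
noncomputable def conv (a b : ℤ → K) (k : ℤ) : K := ∑' i : ℤ, a i * b (k - i)

theorem isOverconvergent_add {a b : ℤ → K} (ha : IsOverconvergent a) (hb : IsOverconvergent b) :
    IsOverconvergent fun k => a k + b k := by
  obtain ⟨ρ, hρ, C, _, h1, h2⟩ := common_bound ha hb
  refine ⟨ρ, hρ, C + C, fun k => (norm_add_le _ _).trans ?_⟩
  rw [add_mul]
  exact add_le_add (h1 k) (h2 k)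

theorem isOverconvergent_neg {a : ℤ → K} (ha : IsOverconvergent a) :
    IsOverconvergent fun k => -a k := by
  obtain ⟨ρ, hρ, C, h⟩ := ha
  exact ⟨ρ, hρ, C, fun k => by simpa using h k⟩

theorem isOverconvergent_single (c : K) : IsOverconvergent (Pi.single (0 : ℤ) c) := by
  refine ⟨2, one_lt_two, ‖c‖, fun k => ?_⟩
  by_cases hk : k = 0
  · subst hk; simp
  · rw [Pi.single_eq_of_ne hk, norm_zero]; positivity

variable [CompleteSpace K]

theorem summable_of_isOverconvergent {a : ℤ → K} (ha : IsOverconvergent a) : Summable fun i => ‖a i‖ := by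
  obtain ⟨ρ, hρ, C, h⟩ := ha
  exact Summable.of_nonneg_of_le (fun _ => norm_nonneg _) h ((summable_inv_pow hρ).mul_left C)

theorem norm_bounded {a : ℤ → K} (ha : IsOverconvergent a) : ∃ C : ℝ, 0 ≤ C ∧ ∀ k, ‖a k‖ ≤ C := by
  obtain ⟨ρ, hρ, C, hC0, h, _⟩ := common_bound ha ha
  refine ⟨C, hC0, fun k => (h k).trans ?_⟩
  exact mul_le_of_le_one_right hC0 (inv_le_one_of_one_le₀ (one_le_pow₀ hρ.le))

theorem summable_conv {a b : ℤ → K} (ha : IsOverconvergent a) (hb : IsOverconvergent b) (k : ℤ) :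
    Summable fun i : ℤ => a i * b (k - i) := by
  obtain ⟨C, _, hC⟩ := norm_bounded hb
  refine Summable.of_norm_bounded ((summable_of_isOverconvergent ha).mul_right C) fun i => ?_
  rw [norm_mul]
  exact mul_le_mul_of_nonneg_left (hC _) (norm_nonneg _)

theorem isOverconvergent_conv {a b : ℤ → K} (ha : IsOverconvergent a)
    (hb : IsOverconvergent b) : IsOverconvergent (conv a b) := by
  obtain ⟨ρ, hρ, C, hC0, h1, h2⟩ := common_bound ha hb
  set s := Real.sqrt ρ with hs
  have hs1 : 1 < s := by
    rw [hs]; exact Real.lt_sqrt_of_sq_lt (by simpa using hρ)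
  have hs0 : 0 < s := by linarith
  have hss : s * s = ρ := Real.mul_self_sqrt (by linarith)
  have key : ∀ k i : ℤ, ‖a i * b (k - i)‖ ≤ C * C * (s ^ k.natAbs)⁻¹ * (s ^ i.natAbs)⁻¹ := by
    intro k i
    have hk : k.natAbs ≤ i.natAbs + (k - i).natAbs := by omega
    have e : (ρ ^ i.natAbs)⁻¹ * (ρ ^ (k - i).natAbs)⁻¹ ≤ (s ^ k.natAbs)⁻¹ * (s ^ i.natAbs)⁻¹ := by
      rw [← mul_inv, ← mul_inv, ← pow_add, ← pow_add, ← hss, ← pow_two, ← pow_mul]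
      exact inv_anti₀ (pow_pos hs0 _) (pow_le_pow_right₀ hs1.le (by omega))
    rw [norm_mul]
    calc ‖a i‖ * ‖b (k - i)‖
        ≤ (C * (ρ ^ i.natAbs)⁻¹) * (C * (ρ ^ (k - i).natAbs)⁻¹) :=
          mul_le_mul (h1 i) (h2 _) (norm_nonneg _) ((norm_nonneg _).trans (h1 i))
      _ = C * C * ((ρ ^ i.natAbs)⁻¹ * (ρ ^ (k - i).natAbs)⁻¹) := by ring
      _ ≤ C * C * ((s ^ k.natAbs)⁻¹ * (s ^ i.natAbs)⁻¹) :=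
          mul_le_mul_of_nonneg_left e (mul_nonneg hC0 hC0)
      _ = _ := by ring
  refine ⟨s, hs1, C * C * ∑' i : ℤ, (s ^ i.natAbs)⁻¹, fun k => ?_⟩
  have hsum := (summable_inv_pow hs1).mul_left (C * C * (s ^ k.natAbs)⁻¹)
  have := tsum_of_norm_bounded hsum.hasSum (key k)
  rw [tsum_mul_left] at this
  calc ‖conv a b k‖ ≤ _ := this
    _ = _ := by ring

theorem conv_comm (a b : ℤ → K) : conv a b = conv b a := by
  funext k
  unfold conv
  rw [← (Equiv.subLeft k).tsum_eq fun i => a i * b (k - i)]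
  refine tsum_congr fun i => ?_
  simp [Equiv.subLeft, mul_comm]

theorem conv_add {a b c : ℤ → K} (ha : IsOverconvergent a) (hb : IsOverconvergent b)
    (hc : IsOverconvergent c) : conv a (fun k => b k + c k) = fun k => conv a b k + conv a c k := by
  funext k
  unfold conv
  rw [← (summable_conv ha hb k).tsum_add (summable_conv ha hc k)]
  exact tsum_congr fun i => mul_add _ _ _

theorem conv_assoc {a b c : ℤ → K} (ha : IsOverconvergent a) (hb : IsOverconvergent b)
    (hc : IsOverconvergent c) : conv (conv a b) c = conv a (conv b c) := by
  funext k
  have hS : Summable fun x : ℤ × ℤ => a x.2 * b (x.1 - x.2) * c (k - x.1) := by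
    obtain ⟨B, _, hB⟩ := norm_bounded hb
    have h1 : Summable fun x : ℤ × ℤ => ‖c (k - x.1)‖ * ‖a x.2‖ := by
      refine Summable.mul_of_nonneg (f := fun i => ‖c (k - i)‖) (g := fun j => ‖a j‖) ?_
        (summable_of_isOverconvergent ha) (fun _ => norm_nonneg _) (fun _ => norm_nonneg _)
      exact (Equiv.subLeft k).summable_iff.2 (summable_of_isOverconvergent hc)
    refine Summable.of_norm_bounded (h1.mul_left B) fun x => ?_
    rw [norm_mul, norm_mul]
    calc ‖a x.2‖ * ‖b (x.1 - x.2)‖ * ‖c (k - x.1)‖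
        = ‖b (x.1 - x.2)‖ * (‖c (k - x.1)‖ * ‖a x.2‖) := by ring
      _ ≤ B * (‖c (k - x.1)‖ * ‖a x.2‖) :=
          mul_le_mul_of_nonneg_right (hB _) (mul_nonneg (norm_nonneg _) (norm_nonneg _))
  calc conv (conv a b) c k = ∑' i : ℤ, ∑' j : ℤ, a j * b (i - j) * c (k - i) := by
        unfold conv
        exact tsum_congr fun i => tsum_mul_right.symm
    _ = ∑' j : ℤ, ∑' i : ℤ, a j * b (i - j) * c (k - i) :=
        Summable.tsum_comm (f := fun j i => a j * b (i - j) * c (k - i))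
          ((Equiv.prodComm ℤ ℤ).summable_iff.2 hS)
    _ = conv a (conv b c) k := by
        unfold conv
        refine tsum_congr fun j => ?_
        rw [← tsum_mul_left, ← (Equiv.addRight j).tsum_eq fun i => a j * b (i - j) * c (k - i)]
        refine tsum_congr fun i => ?_
        simp only [Equiv.coe_addRight, add_sub_cancel_right, mul_assoc]
        congr 3
        ring

theorem single_conv (c : K) (a : ℤ → K) : conv (Pi.single (0 : ℤ) c) a = fun k => c * a k := by
  funext k
  unfold conv
  rw [tsum_eq_single (0 : ℤ)]
  · simp
  · intro i hi
    rw [Pi.single_eq_of_ne hi, zero_mul]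

noncomputable instance : Zero (HDagger K) := ⟨⟨Pi.single 0 0, isOverconvergent_single 0⟩⟩
noncomputable instance : One (HDagger K) := ⟨⟨Pi.single 0 1, isOverconvergent_single 1⟩⟩
noncomputable instance : Add (HDagger K) :=
  ⟨fun f g => ⟨fun k => f.coeff k + g.coeff k, isOverconvergent_add f.2 g.2⟩⟩
noncomputable instance : Neg (HDagger K) :=
  ⟨fun f => ⟨fun k => -f.coeff k, isOverconvergent_neg f.2⟩⟩
noncomputable instance : Mul (HDagger K) :=
  ⟨fun f g => ⟨conv f.coeff g.coeff, isOverconvergent_conv f.2 g.2⟩⟩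

theorem coeff_zero (k : ℤ) : (0 : HDagger K).coeff k = 0 := by
  change (Pi.single (0 : ℤ) (0 : K) : ℤ → K) k = 0
  simp

theorem coeff_one : (1 : HDagger K).coeff = Pi.single (0 : ℤ) (1 : K) := rfl

theorem coeff_add (f g : HDagger K) (k : ℤ) : (f + g).coeff k = f.coeff k + g.coeff k := rfl

theorem coeff_neg (f : HDagger K) (k : ℤ) : (-f).coeff k = -f.coeff k := rfl

theorem coeff_mul (f g : HDagger K) : (f * g).coeff = conv f.coeff g.coeff := rfl

theorem mul_comm_aux (f g : HDagger K) : f * g = g * f := HDagger.ext (conv_comm _ _)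

theorem mul_add_aux (f g h : HDagger K) : f * (g + h) = f * g + f * h :=
  HDagger.ext (conv_add f.2 g.2 h.2)

theorem one_mul_aux (f : HDagger K) : 1 * f = f :=
  HDagger.ext ((single_conv 1 f.coeff).trans (by simp))

theorem zero_mul_aux (f : HDagger K) : 0 * f = 0 :=
  HDagger.ext ((single_conv 0 f.coeff).trans (by funext k; rw [coeff_zero, zero_mul]))

noncomputable instance : CommRing (HDagger K) where
  add_assoc f g h := HDagger.ext (funext fun _ => add_assoc _ _ _)
  zero_add f := HDagger.ext (funext fun k => by rw [coeff_add, coeff_zero, zero_add])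
  add_zero f := HDagger.ext (funext fun k => by rw [coeff_add, coeff_zero, add_zero])
  add_comm f g := HDagger.ext (funext fun _ => add_comm _ _)
  neg_add_cancel f := HDagger.ext (funext fun k => by
    rw [coeff_add, coeff_neg, coeff_zero, neg_add_cancel])
  mul_assoc f g h := HDagger.ext (conv_assoc f.2 g.2 h.2)
  mul_comm := mul_comm_aux
  one_mul := one_mul_aux
  mul_one f := (mul_comm_aux f 1).trans (one_mul_aux f)
  zero_mul := zero_mul_aux
  mul_zero f := (mul_comm_aux f 0).trans (zero_mul_aux f)
  left_distrib := mul_add_aux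
  right_distrib f g h := by
    rw [mul_comm_aux, mul_add_aux, mul_comm_aux h f, mul_comm_aux h g]
  nsmul := nsmulRec
  zsmul := zsmulRec

end Ring

end HDagger

/-- The value at `x` of the Laurent series with coefficients `a`. -/
noncomputable def laurentEval {K : Type*} [NormedField K] (a : ℤ → K) (x : K) : K :=
  ∑' k : ℤ, a k * x ^ k

/-- The group `D⁻(1,1) = {q ∈ K : |q - 1| < 1}`. -/
def unitDisk (K : Type*) [NormedField K] [IsUltrametricDist K] : Subgroup Kˣ where
  carrier := {q | ‖(q : K) - 1‖ < 1}
  one_mem' := by simp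
  mul_mem' := by
    intro a b ha hb
    simp only [Set.mem_ofPred_eq, Units.val_mul] at *
    have h : (a : K) * b - 1 = (a - 1) * (b - 1) + ((a - 1) + (b - 1)) := by ring
    rw [h]
    refine (IsUltrametricDist.norm_add_le_max _ _).trans_lt (max_lt ?_ ?_)
    · rw [norm_mul]
      exact mul_lt_one_of_nonneg_of_lt_one_left (norm_nonneg _) ha hb.le
    · exact (IsUltrametricDist.norm_add_le_max _ _).trans_lt (max_lt ha hb)
  inv_mem' := by
    intro a ha
    simp only [Set.mem_ofPred_eq] at *
    have h1 : ‖(a : K)‖ = 1 := by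
      have h2 := IsUltrametricDist.norm_add_eq_max_of_norm_ne_norm
        (x := (a : K) - 1) (y := 1) (by rw [norm_one]; exact ha.ne)
      rw [sub_add_cancel, norm_one, max_eq_right ha.le] at h2
      exact h2
    have h3 : ((a⁻¹ : Kˣ) : K) - 1 = -(((a⁻¹ : Kˣ) : K) * (a - 1)) := by
      rw [mul_sub, Units.inv_mul]; ring
    rw [h3, norm_neg, norm_mul, Units.val_inv_eq_inv_val, norm_inv, h1]
    simpa using ha

section Operators

variable {K : Type*} [NormedField K] [IsUltrametricDist K] [CompleteSpace K]

theorem norm_eq_one_of_mem_unitDisk (q : unitDisk K) : ‖((q : Kˣ) : K)‖ = 1 := by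
  have hq : ‖((q : Kˣ) : K) - 1‖ < 1 := q.2
  have h2 := IsUltrametricDist.norm_add_eq_max_of_norm_ne_norm
    (x := ((q : Kˣ) : K) - 1) (y := 1) (by rw [norm_one]; exact hq.ne)
  rwa [sub_add_cancel, norm_one, max_eq_right hq.le] at h2

/-- The operator `σ_q : f(T) ↦ f(qT)` on `H†_K`, for `|q - 1| < 1`. -/
noncomputable def sigmaHom (q : unitDisk K) : HDagger K →+* HDagger K where
  toFun f := ⟨fun k => ((q : Kˣ) : K) ^ k * f.coeff k, by
    obtain ⟨ρ, hρ, C, h⟩ := f.2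
    exact ⟨ρ, hρ, C, fun k => by simpa [norm_eq_one_of_mem_unitDisk q] using h k⟩⟩
  map_one' := by
    ext k
    by_cases hk : k = 0
    · subst hk; simp [HDagger.coeff_one]
    · simp [HDagger.coeff_one, Pi.single_eq_of_ne hk]
  map_zero' := by ext k; simp [HDagger.coeff_zero]
  map_add' f g := by ext k; simp [HDagger.coeff_add, mul_add]
  map_mul' f g := by
    ext k
    simp only [HDagger.coeff_mul, HDagger.conv]
    rw [← tsum_mul_left]
    refine tsum_congr fun i => ?_
    have : ((q : Kˣ) : K) ^ k = ((q : Kˣ) : K) ^ i * ((q : Kˣ) : K) ^ (k - i) := by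
      rw [← zpow_add₀ (Units.ne_zero _)]; congr 1; ring
    rw [this]; ring

end Operators

/-- An absolute Frobenius of `K`: a ring endomorphism lifting the `p`-th power map of the
residue field. -/
structure AbsoluteFrobenius (p : ℕ) (K : Type*) [NormedField K] extends K →+* K where
  lifts : ∀ x : K, ‖x‖ ≤ 1 → ‖toRingHom x - x ^ p‖ < 1

section Frobenius

variable {K : Type*} [NormedField K] [IsUltrametricDist K] {p : ℕ}

/-- An absolute Frobenius maps the valuation ring to itself. -/
theorem AbsoluteFrobenius.norm_le_one (φ : AbsoluteFrobenius p K) {x : K} (hx : ‖x‖ ≤ 1) :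
    ‖φ.toRingHom x‖ ≤ 1 := by
  have h := IsUltrametricDist.norm_add_le_max (φ.toRingHom x - x ^ p) (x ^ p)
  rw [sub_add_cancel] at h
  refine h.trans (max_le (φ.lifts x hx).le ?_)
  rw [norm_pow]
  exact pow_le_one₀ (norm_nonneg _) hx

theorem AbsoluteFrobenius.norm_le (φ : AbsoluteFrobenius p K) (hp0 : (p : K) ≠ 0)
    (hp1 : ‖(p : K)‖ < 1) (x : K) : ‖φ.toRingHom x‖ ≤ ‖x‖ := by
  by_cases hx : x = 0
  · simp [hx]
  by_contra hlt
  rw [not_le] at hlt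
  have hx0 : 0 < ‖x‖ := norm_pos_iff.2 hx
  have hπ : 0 < ‖(p : K)‖ := norm_pos_iff.2 hp0
  have hr : 1 < ‖φ.toRingHom x‖ / ‖x‖ := (one_lt_div hx0).2 hlt
  obtain ⟨m, hm⟩ := pow_unbounded_of_one_lt ‖(p : K)‖⁻¹ hr
  obtain ⟨n, hn1, hn2⟩ := exists_mem_Ioc_zpow (pow_pos hx0 m)
    ((one_lt_inv₀ hπ).2 hp1)
  have hpow : ‖φ.toRingHom (x ^ m * (p : K) ^ (n + 1))‖ ≤ 1 := by
    apply φ.norm_le_one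
    rw [norm_mul, norm_pow, norm_zpow]
    rw [inv_zpow] at hn2
    calc ‖x‖ ^ m * ‖(p : K)‖ ^ (n + 1)
        ≤ (‖(p : K)‖ ^ (n + 1))⁻¹ * ‖(p : K)‖ ^ (n + 1) :=
          mul_le_mul_of_nonneg_right hn2 (zpow_nonneg hπ.le _)
      _ = 1 := inv_mul_cancel₀ (zpow_ne_zero _ hπ.ne')
  rw [map_mul, map_pow, map_zpow₀, map_natCast, norm_mul, norm_pow, norm_zpow] at hpow
  rw [div_pow, lt_div_iff₀ (pow_pos hx0 m)] at hm
  have h1 : (‖(p : K)‖ ^ (n + 1))⁻¹ < ‖φ.toRingHom x‖ ^ m := by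
    refine lt_of_le_of_lt ?_ hm
    rw [zpow_add_one₀ hπ.ne', mul_inv, mul_comm]
    rw [inv_zpow] at hn1
    exact mul_le_mul_of_nonneg_left hn1.le (inv_nonneg.2 hπ.le)
  have h2 := mul_lt_mul_of_pos_right h1 (zpow_pos hπ (n + 1))
  rw [inv_mul_cancel₀ (zpow_ne_zero _ hπ.ne')] at h2
  linarith

theorem AbsoluteFrobenius.continuous (φ : AbsoluteFrobenius p K) (hp0 : (p : K) ≠ 0)
    (hp1 : ‖(p : K)‖ < 1) : Continuous φ.toRingHom :=
  AddMonoidHomClass.continuous_of_bound φ.toRingHom 1 fun x => by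
    simpa using φ.norm_le hp0 hp1 x

/-- The coefficients of `f^φ(T^p)`, where `f` has coefficients `a`. -/
def AbsoluteFrobenius.twist (φ : AbsoluteFrobenius p K) (a : ℤ → K) (k : ℤ) : K :=
  if (p : ℤ) ∣ k then φ.toRingHom (a (k / p)) else 0

theorem AbsoluteFrobenius.twist_mul (φ : AbsoluteFrobenius p K) (hp0 : (p : K) ≠ 0)
    (a : ℤ → K) (k : ℤ) : φ.twist a (p * k) = φ.toRingHom (a k) := by
  have hp : (p : ℤ) ≠ 0 := fun h => hp0 (by
    have h' : p = 0 := by exact_mod_cast h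
    rw [h', Nat.cast_zero])
  simp [AbsoluteFrobenius.twist, Int.mul_ediv_cancel_left _ hp]

theorem AbsoluteFrobenius.twist_of_not_dvd (φ : AbsoluteFrobenius p K) (a : ℤ → K) {k : ℤ}
    (hk : ¬ (p : ℤ) ∣ k) : φ.twist a k = 0 := if_neg hk

theorem AbsoluteFrobenius.isOverconvergent_twist (φ : AbsoluteFrobenius p K) (hp0 : (p : K) ≠ 0)
    (hp1 : ‖(p : K)‖ < 1) {a : ℤ → K} (ha : IsOverconvergent a) :
    IsOverconvergent (φ.twist a) := by
  obtain ⟨ρ, hρ, C, hC0, h, _⟩ := HDagger.common_bound ha ha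
  have hp : p ≠ 0 := fun h => hp0 (by
    have h' : p = 0 := by exact_mod_cast h
    rw [h', Nat.cast_zero])
  set s : ℝ := ρ ^ ((p : ℝ)⁻¹) with hs
  have hs1 : 1 < s := Real.one_lt_rpow hρ (inv_pos.2 (by exact_mod_cast Nat.pos_of_ne_zero hp))
  have hsp : s ^ p = ρ := Real.rpow_inv_natCast_pow (by linarith) hp
  refine ⟨s, hs1, C, fun k => ?_⟩
  by_cases hk : (p : ℤ) ∣ k
  · obtain ⟨m, rfl⟩ := hk
    rw [φ.twist_mul hp0, Int.natAbs_mul, Int.natAbs_natCast, pow_mul, hsp]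
    exact (φ.norm_le hp0 hp1 _).trans (h m)
  · rw [φ.twist_of_not_dvd a hk, norm_zero]
    exact mul_nonneg hC0 (inv_nonneg.2 (pow_nonneg (by linarith) _))

theorem AbsoluteFrobenius.twist_conv [CompleteSpace K] (φ : AbsoluteFrobenius p K)
    (hp0 : (p : K) ≠ 0) (hp1 : ‖(p : K)‖ < 1) {a b : ℤ → K} (ha : IsOverconvergent a)
    (hb : IsOverconvergent b) :
    φ.twist (HDagger.conv a b) = HDagger.conv (φ.twist a) (φ.twist b) := by
  have hp : (p : ℤ) ≠ 0 := fun h => hp0 (by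
    have h' : p = 0 := by exact_mod_cast h
    rw [h', Nat.cast_zero])
  funext k
  by_cases hk : (p : ℤ) ∣ k
  · obtain ⟨m, rfl⟩ := hk
    rw [φ.twist_mul hp0]
    unfold HDagger.conv
    have hinj : Function.Injective fun j : ℤ => (p : ℤ) * j := mul_right_injective₀ hp
    rw [(HDagger.summable_conv ha hb m).map_tsum φ.toRingHom (φ.continuous hp0 hp1),
      ← hinj.tsum_eq (f := fun i => φ.twist a i * φ.twist b (p * m - i))]
    · refine tsum_congr fun j => ?_
      rw [map_mul, φ.twist_mul hp0, ← mul_sub, φ.twist_mul hp0]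
    · intro i hi
      by_contra hni
      apply hi
      have : ¬ (p : ℤ) ∣ i := fun ⟨j, hj⟩ => hni ⟨j, hj.symm⟩
      simp only [φ.twist_of_not_dvd a this, zero_mul]
  · rw [φ.twist_of_not_dvd _ hk]
    unfold HDagger.conv
    symm
    convert tsum_zero using 2
    funext i
    by_cases hi : (p : ℤ) ∣ i
    · have : ¬ (p : ℤ) ∣ k - i := fun h => hk (by simpa using dvd_add h hi)
      rw [φ.twist_of_not_dvd b this, mul_zero]
    · rw [φ.twist_of_not_dvd a hi, zero_mul]

/-- The Frobenius `f(T) ↦ f^φ(T^p)` of `H†_K`. -/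
noncomputable def AbsoluteFrobenius.onHDagger [CompleteSpace K] [CharZero K] [Fact p.Prime]
    (φ : AbsoluteFrobenius p K) (hp : ‖(p : K)‖ < 1) : HDagger K →+* HDagger K where
  toFun f := ⟨φ.twist f.coeff,
    φ.isOverconvergent_twist (Nat.cast_ne_zero.2 (Fact.out : p.Prime).ne_zero) hp f.2⟩
  map_one' := by
    have hp0 : (p : K) ≠ 0 := Nat.cast_ne_zero.2 (Fact.out : p.Prime).ne_zero
    have hpz : (p : ℤ) ≠ 0 := by exact_mod_cast (Fact.out : p.Prime).ne_zero
    ext k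
    simp only [HDagger.coeff_one]
    by_cases hk : (p : ℤ) ∣ k
    · obtain ⟨m, rfl⟩ := hk
      rw [φ.twist_mul hp0]
      by_cases hm : m = 0
      · subst hm; simp
      · rw [Pi.single_eq_of_ne hm, Pi.single_eq_of_ne (mul_ne_zero hpz hm), map_zero]
    · rw [φ.twist_of_not_dvd _ hk, Pi.single_eq_of_ne]
      rintro rfl
      exact hk (dvd_zero _)
  map_zero' := by
    ext k
    simp [AbsoluteFrobenius.twist, HDagger.coeff_zero]
  map_add' f g := by
    ext k
    simp only [AbsoluteFrobenius.twist, HDagger.coeff_add]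
    split_ifs <;> simp
  map_mul' f g := HDagger.ext
    (φ.twist_conv (Nat.cast_ne_zero.2 (Fact.out : p.Prime).ne_zero) hp f.2 g.2)

end Frobenius

section Modules

variable {K : Type*} [NormedField K] [IsUltrametricDist K] [CompleteSpace K]

/-- A discrete `σ`-module structure over the group `G ⊆ D⁻(1,1)` on the `H†_K`-module `M`: an
action of `G` on `M` by additive maps `σ_g^M`, each of them `σ_g`-semilinear. For
`G = Subgroup.zpowers q` this is the structure of a `q`-difference module. -/
@[ext]
structure SigmaStructure (G : Subgroup (unitDisk K)) (M : Type*) [AddCommGroup M]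
    [Module (HDagger K) M] where
  act : G →* AddMonoid.End M
  act_smul : ∀ (g : G) (f : HDagger K) (m : M), act g (f • m) = sigmaHom (g : unitDisk K) f • act g m

/-- The value at `(x, y)` of the matrix `Y(x, y) = ∑_m F_m(y) (x - y)^m`, where the entries of
`F_m` are given by the coefficients of their Laurent series. -/
noncomputable def taylorEval {d : ℕ} (F : ℕ → Matrix (Fin d) (Fin d) (ℤ → K)) (x y : K) :
    Matrix (Fin d) (Fin d) K :=
  fun i j => ∑' m : ℕ, laurentEval (F m i j) y * (x - y) ^ m

namespace SigmaStructure

variable {G : Subgroup (unitDisk K)} {M : Type*} [AddCommGroup M] [Module (HDagger K) M]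

/-- The restriction of a `σ`-module to a smaller group. -/
def res (E : SigmaStructure G M) {G' : Subgroup (unitDisk K)} (h : G' ≤ G) :
    SigmaStructure G' M where
  act := E.act.comp (Subgroup.inclusion h)
  act_smul g f m := E.act_smul (Subgroup.inclusion h g) f m

/-- The matrix `A(g, T)` of `σ_g^M` in the basis `b`: `σ_g^M(b_i) = ∑_j A(g, T)_{ij} b_j`. -/
noncomputable def matrix (E : SigmaStructure G M) {d : ℕ} (b : Module.Basis (Fin d) (HDagger K) M)
    (g : G) : Matrix (Fin d) (Fin d) (HDagger K) :=
  fun i j => b.repr (E.act g (b i)) j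

/-- A solvable `σ`-module over `G` (Taylor admissible on `|T| = 1` with generic radius `1`): in
some basis (equivalently, in every basis) there is a matrix
`Y(x, y) = ∑_m F_m(y) (x - y)^m` with `Y(y, y) = 1`, the entries of the `F_m` being analytic
elements on `|T| = 1`, that converges for `|x| = |y| = 1`, `|x - y| < 1` (the radius
`liminf ‖F_m‖^(-1/m)` is at least `1`, `‖.‖` being the sup norm on `|T| = 1`) and that is a
simultaneous solution of all the equations `Y(g x, y) = A(g, x) Y(x, y)`, `g ∈ G`. -/
def IsSolvable (E : SigmaStructure G M) : Prop :=
  ∃ (d : ℕ) (b : Module.Basis (Fin d) (HDagger K) M) (F : ℕ → Matrix (Fin d) (Fin d) (ℤ → K)),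
    (∀ m i j, Tendsto (F m i j) cofinite (𝓝 0)) ∧
    (∀ r : ℝ, 0 ≤ r → r < 1 → ∃ C : ℝ, ∀ m i j k, ‖F m i j k‖ * r ^ m ≤ C) ∧
    (∀ y : K, ‖y‖ = 1 → taylorEval F y y = 1) ∧
    ∀ (g : G) (x y : K), ‖x‖ = 1 → ‖y‖ = 1 → ‖x - y‖ < 1 →
      taylorEval F (((g : unitDisk K) : Kˣ) * x) y =
        (E.matrix b g).map (fun f => laurentEval f.coeff x) * taylorEval F x y

/-- `M` is isomorphic, as a `σ`-module over `G`, to a direct sum of copies of the unit object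
`(H†_K, σ)`. -/
def IsTrivial (E : SigmaStructure G M) : Prop :=
  ∃ (d : ℕ) (e : M ≃ₗ[HDagger K] (Fin d → HDagger K)),
    ∀ (g : G) (m : M) (i : Fin d), e (E.act g m) i = sigmaHom (g : unitDisk K) (e m i)

/-- `E` is the inverse image of the `σ_q`-module `(M, σ)` under the restriction functor from
solvable `σ`-modules over `D⁻(1,1)` to `σ_q`-modules. -/
def IsTaylorExtension {q : unitDisk K} (σ : SigmaStructure (Subgroup.zpowers q) M)
    (E : SigmaStructure (⊤ : Subgroup (unitDisk K)) M) : Prop :=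
  E.IsSolvable ∧ E.res le_top = σ

/-- `D` is the Taylor deformation `Def_{q,q'}(M)`: the restriction to `q'` of the
solvable extension of `(M, σ_q)` to `D⁻(1,1)`. -/
def IsTaylorDeformation {q q' : unitDisk K} (σ : SigmaStructure (Subgroup.zpowers q) M)
    (D : SigmaStructure (Subgroup.zpowers q') M) : Prop :=
  ∃ E : SigmaStructure (⊤ : Subgroup (unitDisk K)) M, σ.IsTaylorExtension E ∧ E.res le_top = D

/-- The solvable `σ_q`-module `(M, σ)` has a Frobenius structure: for some `h ≥ 1` there is an
isomorphism `(φ^*)^h M ≅ M` of `σ_q`-modules, where `σ_q` acts on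
`(φ^*)^h M = M ⊗_{B, φ^h} B`, `B = H†_K`, by `σ_{q'}^M ⊗ σ_q`, with `φ^h(q') = q^(p^h)`
(so that `φ^h ∘ σ_{q'} = σ_q ∘ φ^h` on `B`; if `φ(q) = q`, then `q' = q^(p^h)`), the operator
`σ_{q'}^M` being that of the extension of `M` to `D⁻(1,1)`.
A `B`-linear isomorphism `M ⊗_{B, φ^h} B ≅ M` is given as the `φ^h`-semilinear map
`Φ(m) = (image of m ⊗ 1)`, which sends a basis of `M` to a basis of `M`. -/
def HasFrobeniusStructure [CharZero K] {p : ℕ} [Fact p.Prime] (φ : AbsoluteFrobenius p K)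
    (hp : ‖(p : K)‖ < 1) {q : unitDisk K} (σ : SigmaStructure (Subgroup.zpowers q) M) : Prop :=
  ∃ h : ℕ, 1 ≤ h ∧ ∃ E : SigmaStructure (⊤ : Subgroup (unitDisk K)) M, σ.IsTaylorExtension E ∧
    ∃ q' : unitDisk K, φ.toRingHom^[h] ((q' : Kˣ) : K) = ((q : Kˣ) : K) ^ p ^ h ∧
    ∃ Φ : M →ₛₗ[φ.onHDagger hp ^ h] M,
      (∃ (d : ℕ) (b b' : Module.Basis (Fin d) (HDagger K) M), ∀ i, Φ (b i) = b' i) ∧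
      ∀ m : M, Φ (E.act ⟨q', Subgroup.mem_top q'⟩ m) =
        σ.act ⟨q, Subgroup.mem_zpowers q⟩ (Φ m)

end SigmaStructure

end Modules

/-! Putting y = x in the equation of Y gives A(g,T) = Y(gT,T) (`IsTaylorSolution.eval_matrix`). For
every u in the disc this suggests A(u,T) = Y(uT,T) = Σ F_m(T)((u-1)T)^m as the matrix of σ_u. The
identities needed are proved by analytic continuation in u: at fixed x, y both sides are power
series in u-1, they agree at u = q^n, and the points q^{p^n} differ from 1 and tend to 1
(`eq_of_eq_on_powers`). This gives Y(ux,y) = A(u,x)Y(x,y), hence the cocycle relation, and also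
uniqueness. A Laurent series is recovered from its values on the circle by counting zeros
(`eq_zero_of_laurentEval_eq_zero`).

The delicate point is that A(u,T) has entries in B: a priori its coefficients merely tend to zero.
For u = q^n the matrix is a product of n translates of A(q,T), so its k-th coefficient is at most
C^n ρ^{-|k|} with fixed ρ > 1 and C. As a function of z = u-1, that coefficient is a power series
bounded on |z| < r < 1 uniformly in k. Expand it in the Newton basis with nodes q^n-1. Since q is
not a root of unity, products of differences of nodes decrease at most geometrically, so small
values at the nodes force small Newton coefficients. A weighted geometric mean of this bound and the
one from convergence gives O(ρ^{-|k|/(N+1)}) with N independent of k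
(`exists_norm_seriesEval_pow_le`, `IsTaylorFamily.isOverconvergent_taylorCoeff`).

For the second assertion, let Φ be the semilinear Frobenius. The relation Φσ_{q'} = σ_qΦ spreads, by
continuation in v, to Φσ_u = σ_vΦ whenever φ^h(u) = v^{p^h} (`frobenius_act`). Since φ^h is
injective, it permutes the p^n-th roots of unity of K; if ξ^{p^{n+1}} = 1, then ξ^{p^h} = φ^h(ζ) for
some ζ with ζ^{p^n} = 1. Induction shows that σ_ξ fixes Φ^n(M) pointwise when ξ^{p^n} = 1. As Φ^n
sends a basis to a basis, M has a basis of fixed vectors. -/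

/-! ### Summation of ultrametric families. -/

section UltrametricSums

variable {K : Type*} [NormedField K] [IsUltrametricDist K] [CompleteSpace K]

/-- A family on a product tends to zero as soon as its slices do and it is bounded, uniformly in
the second variable, by a family tending to zero. -/
theorem tendsto_cofinite_prod_of_norm_le {α β : Type*} {f : α × β → K} {ε : α → ℝ}
    (hε : Tendsto ε cofinite (𝓝 0)) (hb : ∀ a b, ‖f (a, b)‖ ≤ ε a)
    (hf : ∀ a, Tendsto (fun b => f (a, b)) cofinite (𝓝 0)) : Tendsto f cofinite (𝓝 0) := by
  rw [Metric.tendsto_nhds]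
  intro δ hδ
  have h1 : {a | ¬ ε a < δ}.Finite := by
    have := (tendsto_order.1 hε).2 δ hδ
    exact this
  have h2 : ∀ a, {b | ¬ ‖f (a, b)‖ < δ}.Finite := fun a => by
    have := Metric.tendsto_nhds.1 (hf a) δ hδ
    simpa [dist_zero_right] using this
  refine (Set.Finite.subset (h1.biUnion fun a _ => (h2 a).image (Prod.mk a)) ?_ :
    {x | ¬ dist (f x) 0 < δ}.Finite)
  rintro ⟨a, b⟩ hab
  simp only [Set.mem_ofPred_eq, dist_zero_right] at hab
  simp only [Set.mem_iUnion, Set.mem_image, Set.mem_ofPred_eq]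
  exact ⟨a, fun h => hab ((hb a b).trans_lt h), b, hab, rfl⟩

theorem summable_of_tendsto_zero {α : Type*} {f : α → K} (hf : Tendsto f cofinite (𝓝 0)) :
    Summable f :=
  NonarchimedeanAddGroup.summable_of_tendsto_cofinite_zero hf

theorem norm_tsum_le_of_le {α : Type*} {f : α → K} {C : ℝ} (hC : 0 ≤ C)
    (h : ∀ i, ‖f i‖ ≤ C) : ‖∑' i, f i‖ ≤ C :=
  IsUltrametricDist.norm_tsum_le_of_forall_le_of_nonneg hC h

theorem norm_sub_le_max' (x y : K) : ‖x - y‖ ≤ max ‖x‖ ‖y‖ := by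
  simpa [sub_eq_add_neg] using IsUltrametricDist.norm_add_le_max x (-y)

end UltrametricSums

/-! ### Power series on the open unit disc and their Gauss norms. -/

section DiscSeries

variable {K : Type*} [NormedField K] [IsUltrametricDist K] [CompleteSpace K]

open PowerSeries

/-- The Gauss norm of `c` on the disc of radius `r` is at most `s`. -/
def GaussBound (c : PowerSeries K) (r s : ℝ) : Prop := ∀ m, ‖coeff m c‖ * r ^ m ≤ s

/-- The power series `c` converges on the open unit disc, with bounded Gauss norms. -/
def DiscConvergent (c : PowerSeries K) : Prop :=
  ∀ r : ℝ, 0 ≤ r → r < 1 → ∃ s, GaussBound c r s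

/-- The value of a power series at a point. -/
noncomputable def seriesEval (c : PowerSeries K) (z : K) : K := ∑' m, coeff m c * z ^ m

theorem GaussBound.nonneg {c : PowerSeries K} {r s : ℝ} (h : GaussBound c r s) : 0 ≤ s := by
  have := h 0
  rw [pow_zero, mul_one] at this
  exact (norm_nonneg _).trans this

theorem GaussBound.mono {c : PowerSeries K} {r s t : ℝ} (h : GaussBound c r s) (hst : s ≤ t) :
    GaussBound c r t := fun m => (h m).trans hst

theorem GaussBound.mul {a b : PowerSeries K} {r s t : ℝ} (hr : 0 ≤ r) (ha : GaussBound a r s)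
    (hb : GaussBound b r t) : GaussBound (a * b) r (s * t) := by
  intro m
  rw [coeff_mul, ← Real.norm_of_nonneg (pow_nonneg hr m)]
  have hst := mul_nonneg ha.nonneg hb.nonneg
  -- The radius may be 0, so r^m = 0 is set aside before dividing by it.
  rcases (pow_nonneg hr m).eq_or_lt with h0 | h0
  · rw [← h0]; simpa using hst
  rw [Real.norm_of_nonneg h0.le, ← le_div_iff₀ h0]
  refine IsUltrametricDist.norm_sum_le_of_forall_le_of_nonneg (div_nonneg hst h0.le) ?_
  rintro ⟨i, j⟩ hij
  rw [Finset.HasAntidiagonal.mem_antidiagonal] at hij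
  rw [le_div_iff₀ h0, norm_mul, ← hij, pow_add]
  calc ‖coeff i a‖ * ‖coeff j b‖ * (r ^ i * r ^ j)
      = (‖coeff i a‖ * r ^ i) * (‖coeff j b‖ * r ^ j) := by ring
    _ ≤ s * t := mul_le_mul (ha i) (hb j) (by positivity) ha.nonneg

theorem GaussBound.C (a : K) (r : ℝ) : GaussBound (PowerSeries.C a) r ‖a‖ := by
  intro m
  rw [coeff_C]
  split_ifs with h
  · simp [h]
  · simp

theorem GaussBound.one (r : ℝ) : GaussBound (1 : PowerSeries K) r 1 := by
  simpa using GaussBound.C (1 : K) r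

theorem GaussBound.X {r : ℝ} (hr : 0 ≤ r) : GaussBound (PowerSeries.X : PowerSeries K) r r := by
  intro m
  rw [coeff_X]
  split_ifs with h
  · simp [h]
  · simpa using hr

theorem GaussBound.add {a b : PowerSeries K} {r s : ℝ} (hr : 0 ≤ r) (ha : GaussBound a r s)
    (hb : GaussBound b r s) : GaussBound (a + b) r s := by
  intro m
  rw [map_add]
  have := IsUltrametricDist.norm_add_le_max (coeff m a) (coeff m b)
  calc _ ≤ max ‖coeff m a‖ ‖coeff m b‖ * r ^ m :=
        mul_le_mul_of_nonneg_right this (pow_nonneg hr _)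
    _ ≤ s := by
      rw [max_mul_of_nonneg _ _ (pow_nonneg hr _)]
      exact max_le (ha m) (hb m)

theorem GaussBound.pow {a : PowerSeries K} {r s : ℝ} (hr : 0 ≤ r) (ha : GaussBound a r s) (n : ℕ) :
    GaussBound (a ^ n) r (s ^ n) := by
  induction n with
  | zero => simpa using GaussBound.one r
  | succ n ih => rw [pow_succ, pow_succ]; exact ih.mul hr ha

theorem GaussBound.norm_le {c : PowerSeries K} {r s : ℝ} (hr : 0 < r) (h : GaussBound c r s)
    (z : K) (m : ℕ) : ‖coeff m c * z ^ m‖ ≤ s * (‖z‖ / r) ^ m := by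
  rw [norm_mul, norm_pow, div_pow, mul_div_assoc', le_div_iff₀ (pow_pos hr m)]
  calc ‖coeff m c‖ * ‖z‖ ^ m * r ^ m = ‖coeff m c‖ * r ^ m * ‖z‖ ^ m := by ring
    _ ≤ _ := mul_le_mul_of_nonneg_right (h m) (by positivity)

theorem GaussBound.summable_norm {c : PowerSeries K} {r s : ℝ} (h : GaussBound c r s) {z : K}
    (hz : ‖z‖ < r) : Summable fun m => ‖coeff m c * z ^ m‖ := by
  have hr : 0 < r := (norm_nonneg z).trans_lt hz
  exact Summable.of_nonneg_of_le (fun _ => norm_nonneg _) (h.norm_le hr z)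
    ((summable_geometric_of_lt_one (by positivity) ((div_lt_one hr).2 hz)).mul_left s)

theorem seriesEval_mul {a b : PowerSeries K} {r s t : ℝ} (ha : GaussBound a r s)
    (hb : GaussBound b r t) {z : K} (hz : ‖z‖ < r) :
    seriesEval (a * b) z = seriesEval a z * seriesEval b z := by
  unfold seriesEval
  rw [tsum_mul_tsum_eq_tsum_sum_antidiagonal_of_summable_norm (ha.summable_norm hz)
    (hb.summable_norm hz)]
  refine tsum_congr fun m => ?_
  rw [coeff_mul, Finset.sum_mul]
  refine Finset.sum_congr rfl ?_
  rintro ⟨i, j⟩ hij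
  rw [Finset.HasAntidiagonal.mem_antidiagonal] at hij
  simp only
  rw [← hij, pow_add]; ring

theorem seriesEval_C (a z : K) : seriesEval (PowerSeries.C a) z = a := by
  unfold seriesEval
  rw [tsum_eq_single 0 fun m hm => by rw [coeff_C, if_neg hm, zero_mul]]
  simp

theorem seriesEval_one (z : K) : seriesEval (1 : PowerSeries K) z = 1 := by
  simpa using seriesEval_C (1 : K) z

theorem seriesEval_X (z : K) : seriesEval (PowerSeries.X : PowerSeries K) z = z := by
  unfold seriesEval
  rw [tsum_eq_single 1 fun m hm => by rw [coeff_X, if_neg hm, zero_mul]]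
  simp

theorem seriesEval_add {a b : PowerSeries K} {r s t : ℝ} (ha : GaussBound a r s)
    (hb : GaussBound b r t) {z : K} (hz : ‖z‖ < r) :
    seriesEval (a + b) z = seriesEval a z + seriesEval b z := by
  unfold seriesEval
  rw [← (ha.summable_norm hz).of_norm.tsum_add (hb.summable_norm hz).of_norm]
  exact tsum_congr fun m => by rw [map_add, add_mul]

theorem seriesEval_pow {a : PowerSeries K} {r s : ℝ} (ha : GaussBound a r s) {z : K}
    (hz : ‖z‖ < r) (n : ℕ) : seriesEval (a ^ n) z = seriesEval a z ^ n := by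
  have hr : 0 ≤ r := (norm_nonneg z).trans hz.le
  induction n with
  | zero => simpa using seriesEval_one z
  | succ n ih => rw [pow_succ, pow_succ, seriesEval_mul (ha.pow hr n) ha hz, ih]

/-- The double family of terms is dominated by ε uniformly in the degree, and each slice tends to
zero; ultrametrically this suffices to exchange the sums. -/
theorem seriesEval_tsum {ι : Type*} {c : ι → PowerSeries K} {r : ℝ} {ε : ι → ℝ}
    (hε : Tendsto ε cofinite (𝓝 0)) (h : ∀ i, GaussBound (c i) r (ε i)) {z : K} (hz : ‖z‖ < r) :
    seriesEval (PowerSeries.mk fun m => ∑' i, coeff m (c i)) z = ∑' i, seriesEval (c i) z := by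
  have hr : 0 < r := (norm_nonneg z).trans_lt hz
  unfold seriesEval
  simp only [coeff_mk, ← tsum_mul_right]
  refine Summable.tsum_comm (f := fun i m => coeff m (c i) * z ^ m)
    (summable_of_tendsto_zero (tendsto_cofinite_prod_of_norm_le hε (fun i m => ?_) fun i => ?_))
  · refine ((h i).norm_le hr z m).trans (mul_le_of_le_one_right (h i).nonneg ?_)
    exact pow_le_one₀ (by positivity) ((div_le_one hr).2 hz.le)
  · exact ((h i).summable_norm hz).of_norm.tendsto_cofinite_zero

theorem gaussBound_tsum {ι : Type*} {c : ι → PowerSeries K} {r s : ℝ} (hr : 0 ≤ r) (hs : 0 ≤ s)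
    (h : ∀ i, GaussBound (c i) r s) :
    GaussBound (PowerSeries.mk fun m => ∑' i, coeff m (c i)) r s := by
  intro m
  rcases (pow_nonneg hr m).eq_or_lt with h0 | h0
  · rw [← h0]; simpa using hs
  rw [coeff_mk, ← le_div_iff₀ h0]
  exact norm_tsum_le_of_le (div_nonneg hs h0.le) fun i => (le_div_iff₀ h0).2 (h i m)

end DiscSeries

/-! ### Analytic functions on the disc |u - 1| < 1 and the identity theorem. -/

section DiscFunctions

variable {K : Type*} [NormedField K] [IsUltrametricDist K] [CompleteSpace K]

open PowerSeries

/-- A function on the disc `|u - 1| < 1` given by a convergent power series in `u - 1`. -/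
def IsDiscAnalytic (f : unitDisk K → K) : Prop :=
  ∃ c : PowerSeries K, DiscConvergent c ∧ ∀ u, f u = seriesEval c (((u : Kˣ) : K) - 1)

theorem norm_sub_one_lt (u : unitDisk K) : ‖((u : Kˣ) : K) - 1‖ < 1 := u.2

theorem DiscConvergent.exists_bound {c : PowerSeries K} (hc : DiscConvergent c) {z : K}
    (hz : ‖z‖ < 1) : ∃ r s : ℝ, ‖z‖ < r ∧ r < 1 ∧ GaussBound c r s := by
  obtain ⟨r, h1, h2⟩ := exists_between hz
  obtain ⟨s, hs⟩ := hc r ((norm_nonneg _).trans h1.le) h2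
  exact ⟨r, s, h1, h2, hs⟩

theorem isDiscAnalytic_const (a : K) : IsDiscAnalytic fun _ : unitDisk K => a :=
  ⟨PowerSeries.C a, fun r _ _ => ⟨_, GaussBound.C a r⟩, fun _ => (seriesEval_C _ _).symm⟩

theorem DiscConvergent.exists_common_bound {a b : PowerSeries K} (ha : DiscConvergent a)
    (hb : DiscConvergent b) {r : ℝ} (h0 : 0 ≤ r) (h1 : r < 1) :
    ∃ s, GaussBound a r s ∧ GaussBound b r s := by
  obtain ⟨s, hs⟩ := ha r h0 h1
  obtain ⟨t, ht⟩ := hb r h0 h1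
  exact ⟨max s t, hs.mono (le_max_left _ _), ht.mono (le_max_right _ _)⟩

theorem IsDiscAnalytic.add {f g : unitDisk K → K} (hf : IsDiscAnalytic f) (hg : IsDiscAnalytic g) :
    IsDiscAnalytic fun u => f u + g u := by
  obtain ⟨a, ha, hf⟩ := hf
  obtain ⟨b, hb, hg⟩ := hg
  refine ⟨a + b, fun r h0 h1 => ?_, fun u => ?_⟩
  · obtain ⟨s, hs, ht⟩ := ha.exists_common_bound hb h0 h1
    exact ⟨s, hs.add h0 ht⟩
  · obtain ⟨r, h1, h2⟩ := exists_between (norm_sub_one_lt u)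
    obtain ⟨s, hs, ht⟩ := ha.exists_common_bound hb ((norm_nonneg _).trans h1.le) h2
    beta_reduce
    rw [hf, hg, seriesEval_add hs ht h1]

theorem IsDiscAnalytic.mul {f g : unitDisk K → K} (hf : IsDiscAnalytic f) (hg : IsDiscAnalytic g) :
    IsDiscAnalytic fun u => f u * g u := by
  obtain ⟨a, ha, hf⟩ := hf
  obtain ⟨b, hb, hg⟩ := hg
  refine ⟨a * b, fun r h0 h1 => ?_, fun u => ?_⟩
  · obtain ⟨s, hs, ht⟩ := ha.exists_common_bound hb h0 h1
    exact ⟨_, hs.mul h0 ht⟩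
  · obtain ⟨r, h1, h2⟩ := exists_between (norm_sub_one_lt u)
    obtain ⟨s, hs, ht⟩ := ha.exists_common_bound hb ((norm_nonneg _).trans h1.le) h2
    beta_reduce
    rw [hf, hg, seriesEval_mul hs ht h1]

theorem IsDiscAnalytic.sum {ι : Type*} (s : Finset ι) {f : ι → unitDisk K → K}
    (hf : ∀ i ∈ s, IsDiscAnalytic (f i)) : IsDiscAnalytic fun u => ∑ i ∈ s, f i u := by
  classical
  induction s using Finset.induction_on with
  | empty => simpa using isDiscAnalytic_const (0 : K)
  | insert a s ha ih =>
    simp only [Finset.sum_insert ha]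
    exact (hf a (Finset.mem_insert_self _ _)).add
      (ih fun i hi => hf i (Finset.mem_insert_of_mem hi))

/-- An infinite sum of series that tend to zero for all Gauss norms of radius less than `1`. -/
theorem isDiscAnalytic_tsum {ι : Type*} (c : ι → PowerSeries K)
    (h : ∀ r : ℝ, 0 ≤ r → r < 1 → ∃ ε : ι → ℝ, Tendsto ε cofinite (𝓝 0) ∧
      ∀ i, GaussBound (c i) r (ε i)) :
    IsDiscAnalytic fun u : unitDisk K => ∑' i, seriesEval (c i) (((u : Kˣ) : K) - 1) := by
  refine ⟨PowerSeries.mk fun m => ∑' i, coeff m (c i), fun r h0 h1 => ?_, fun u => ?_⟩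
  · obtain ⟨ε, hε, hc⟩ := h r h0 h1
    obtain ⟨s, hs⟩ := hε.bddAbove_range_of_cofinite
    refine ⟨max s 0, gaussBound_tsum h0 (le_max_right _ _) fun i => ?_⟩
    exact (hc i).mono ((hs ⟨i, rfl⟩).trans (le_max_left _ _))
  · obtain ⟨r, h1, h2⟩ := exists_between (norm_sub_one_lt u)
    obtain ⟨ε, hε, hc⟩ := h r ((norm_nonneg _).trans h1.le) h2
    exact (seriesEval_tsum hε hc h1).symm

/-- Boundedness at a radius t strictly between s and 1 leaves a factor (s/t)^m at radius s. -/
theorem tendsto_mul_pow_of_bound {L : ℕ → ℝ} (hL0 : ∀ m, 0 ≤ L m)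
    (hL : ∀ r : ℝ, 0 ≤ r → r < 1 → ∃ C, ∀ m, L m * r ^ m ≤ C) {s : ℝ} (h0 : 0 ≤ s) (h1 : s < 1) :
    Tendsto (fun m => L m * s ^ m) cofinite (𝓝 0) := by
  obtain ⟨t, hst, ht⟩ := exists_between h1
  have ht0 : 0 < t := h0.trans_lt hst
  obtain ⟨C, hC⟩ := hL t ht0.le ht
  rw [Nat.cofinite_eq_atTop]
  have : Tendsto (fun m : ℕ => C * (s / t) ^ m) atTop (𝓝 0) := by
    simpa using (tendsto_pow_atTop_nhds_zero_of_lt_one (by positivity)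
      ((div_lt_one ht0).2 hst)).const_mul C
  refine squeeze_zero (fun m => mul_nonneg (hL0 m) (by positivity)) (fun m => ?_) this
  rw [div_pow, mul_div_assoc', le_div_iff₀ (by positivity)]
  calc L m * s ^ m * t ^ m = L m * t ^ m * s ^ m := by ring
    _ ≤ _ := mul_le_mul_of_nonneg_right (hC m) (by positivity)

/-- Substitution of a series that maps the open unit disc to itself. -/
theorem isDiscAnalytic_comp {L : ℕ → K}
    (hL : ∀ r : ℝ, 0 ≤ r → r < 1 → ∃ C, ∀ m, ‖L m‖ * r ^ m ≤ C) {g : PowerSeries K}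
    (hg : ∀ r : ℝ, 0 ≤ r → r < 1 → ∃ s, s < 1 ∧ GaussBound g r s) :
    IsDiscAnalytic fun u : unitDisk K => ∑' m, L m * seriesEval g (((u : Kˣ) : K) - 1) ^ m := by
  have key := isDiscAnalytic_tsum (fun m => PowerSeries.C (L m) * g ^ m) fun r h0 h1 => by
    obtain ⟨s, hs1, hs⟩ := hg r h0 h1
    exact ⟨fun m => ‖L m‖ * s ^ m, tendsto_mul_pow_of_bound (fun m => norm_nonneg _) hL hs.nonneg hs1,
      fun m => (GaussBound.C _ _).mul h0 (hs.pow h0 m)⟩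
  refine (congrArg IsDiscAnalytic (funext fun u => ?_)).mpr key
  refine tsum_congr fun m => ?_
  obtain ⟨r, h1, h2⟩ := exists_between (norm_sub_one_lt u)
  have h0 := (norm_nonneg _).trans h1.le
  obtain ⟨s, hs1, hs⟩ := hg r h0 h2
  rw [seriesEval_mul (GaussBound.C _ r) (hs.pow h0 m) h1, seriesEval_C, seriesEval_pow hs h1]

/-- A power series that vanishes along a sequence of nonzero points tending to zero is zero. -/
theorem eq_zero_of_seriesEval_eq_zero {c : PowerSeries K} (hc : DiscConvergent c) {z : ℕ → K}
    (hz : Tendsto z atTop (𝓝 0)) (hz0 : ∀ n, z n ≠ 0) (h : ∀ n, seriesEval c (z n) = 0) : c = 0 := by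
  by_contra hne
  obtain ⟨s, hs⟩ := hc (1 / 2) (by norm_num) (by norm_num)
  classical
  have hex : ∃ m, coeff m c ≠ 0 := by
    by_contra hall
    push Not at hall
    exact hne (PowerSeries.ext fun m => by simpa using hall m)
  set m := Nat.find hex with hm
  have hm0 : coeff m c ≠ 0 := Nat.find_spec hex
  have hlt : ∀ i < m, coeff i c = 0 := fun i hi => not_not.1 (Nat.find_min hex hi)
  -- At a zero x the lowest term c_m x^m is cancelled by the remaining terms, which are
  -- O(|x|^{m+1}). Letting x run through the zeros tending to 0 then kills c_m.
  have hbound : ∀ x : K, x ≠ 0 → ‖x‖ < 1 / 2 → seriesEval c x = 0 →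
      ‖coeff m c‖ ≤ s * 2 ^ (m + 1) * ‖x‖ := by
    intro x hx0 hx hev
    have hsum := (hs.summable_norm hx).of_norm
    have h1 : seriesEval c x = coeff m c * x ^ m +
        ∑' i, if i = m then 0 else coeff i c * x ^ i := hsum.tsum_eq_add_tsum_ite m
    have hx' : 0 < ‖x‖ := norm_pos_iff.2 hx0
    have h2 : ‖∑' i, if i = m then 0 else coeff i c * x ^ i‖ ≤ s * (2 * ‖x‖) ^ (m + 1) := by
      have hs0 := hs.nonneg
      refine norm_tsum_le_of_le (by positivity) fun i => ?_
      split_ifs with him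
      · rw [norm_zero]; positivity
      · rcases lt_or_gt_of_ne him with hi | hi
        · rw [hlt i hi]; simp only [zero_mul, norm_zero]; positivity
        · refine (hs.norm_le (by norm_num) x i).trans (mul_le_mul_of_nonneg_left ?_ hs0)
          have : ‖x‖ / (1 / 2) = 2 * ‖x‖ := by ring
          rw [this]
          exact pow_le_pow_of_le_one (by positivity) (by linarith) hi
    rw [hev] at h1
    have h3 : ‖coeff m c‖ * ‖x‖ ^ m ≤ s * (2 * ‖x‖) ^ (m + 1) := by
      rw [← norm_pow, ← norm_mul, eq_neg_of_add_eq_zero_left h1.symm, norm_neg]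
      exact h2
    have : s * (2 * ‖x‖) ^ (m + 1) = s * 2 ^ (m + 1) * ‖x‖ * ‖x‖ ^ m := by ring
    rw [this] at h3
    exact le_of_mul_le_mul_right h3 (by positivity)
  have hlim : Tendsto (fun n => s * 2 ^ (m + 1) * ‖z n‖) atTop (𝓝 0) := by
    simpa using (tendsto_norm_zero.comp hz).const_mul (s * 2 ^ (m + 1))
  have hsmall : ∀ᶠ n in atTop, ‖z n‖ < 1 / 2 := by
    simpa using (tendsto_norm_zero.comp hz).eventually (gt_mem_nhds (by norm_num : (0:ℝ) < 1 / 2))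
  have : ‖coeff m c‖ ≤ 0 := by
    refine ge_of_tendsto hlim ?_
    filter_upwards [hsmall] with n hn
    exact hbound _ (hz0 n) hn (h n)
  exact hm0 (norm_le_zero_iff.1 this)

theorem IsDiscAnalytic.eq_of_eq_on_seq {f g : unitDisk K → K} (hf : IsDiscAnalytic f)
    (hg : IsDiscAnalytic g) {w : ℕ → unitDisk K}
    (hw : Tendsto (fun n => ((w n : Kˣ) : K)) atTop (𝓝 1)) (hw1 : ∀ n, w n ≠ 1)
    (h : ∀ n, f (w n) = g (w n)) : f = g := by
  obtain ⟨c, hc, hfc⟩ := hf.add ((isDiscAnalytic_const (-1)).mul hg)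
  have : c = 0 := by
    refine eq_zero_of_seriesEval_eq_zero hc (z := fun n => ((w n : Kˣ) : K) - 1) ?_ ?_ ?_
    · simpa using hw.sub_const 1
    · intro n hn
      refine hw1 n (Subtype.ext (Units.ext ?_))
      simpa using sub_eq_zero.1 hn
    · intro n
      rw [← hfc]
      beta_reduce
      rw [h]; ring
  funext u
  have hu := hfc u
  rw [this] at hu
  simp only [seriesEval, map_zero, zero_mul, tsum_zero] at hu
  linear_combination hu

end DiscFunctions

/-! ### Laurent series on the unit circle and their dependence on a rotation. -/

section LaurentSeries

variable {K : Type*} [NormedField K] [IsUltrametricDist K] [CompleteSpace K]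

theorem tendsto_mul_zpow {a : ℤ → K} (ha : Tendsto a cofinite (𝓝 0)) {x : K} (hx : ‖x‖ = 1) :
    Tendsto (fun k => a k * x ^ k) cofinite (𝓝 0) := by
  rw [tendsto_zero_iff_norm_tendsto_zero] at ha ⊢
  simpa [hx] using ha

theorem summable_mul_zpow {a : ℤ → K} (ha : Tendsto a cofinite (𝓝 0)) {x : K} (hx : ‖x‖ = 1) :
    Summable fun k => a k * x ^ k :=
  summable_of_tendsto_zero (tendsto_mul_zpow ha hx)

theorem HDagger.tendsto_coeff (f : HDagger K) : Tendsto f.coeff cofinite (𝓝 0) :=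
  tendsto_zero_iff_norm_tendsto_zero.2
    (HDagger.summable_of_isOverconvergent f.overconvergent).tendsto_cofinite_zero

/-- Evaluation of overconvergent series at a point of the unit circle. -/
noncomputable def HDagger.evalHom (x : K) (hx : ‖x‖ = 1) : HDagger K →+* K where
  toFun f := laurentEval f.coeff x
  map_one' := by
    unfold laurentEval
    rw [tsum_eq_single 0 fun k hk => by rw [HDagger.coeff_one, Pi.single_eq_of_ne hk, zero_mul]]
    simp [HDagger.coeff_one]
  map_zero' := by simp [laurentEval, HDagger.coeff_zero]
  map_add' f g := by
    unfold laurentEval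
    rw [← (summable_mul_zpow f.tendsto_coeff hx).tsum_add (summable_mul_zpow g.tendsto_coeff hx)]
    exact tsum_congr fun k => by rw [HDagger.coeff_add, add_mul]
  map_mul' f g := by
    have hx0 : x ≠ 0 := norm_ne_zero_iff.1 (by rw [hx]; exact one_ne_zero)
    have hs : ∀ h : HDagger K, Summable fun k => ‖h.coeff k * x ^ k‖ := fun h => by
      simpa [hx] using HDagger.summable_of_isOverconvergent h.overconvergent
    unfold laurentEval
    rw [tsum_mul_tsum_of_summable_norm (hs f) (hs g)]
    have hsum := summable_mul_of_summable_norm (hs f) (hs g)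
    rw [hsum.tsum_prod]
    -- The change of indices (i, j) ↦ (i, i + j) turns the double sum of the product into the sum of
    -- the convolution.
    have hS : Summable fun z : ℤ × ℤ => f.coeff z.1 * g.coeff (z.2 - z.1) * x ^ z.2 := by
      have := (Equiv.summable_iff
        ({ toFun := fun z => (z.1, z.2 - z.1), invFun := fun z => (z.1, z.2 + z.1),
           left_inv := fun z => by simp, right_inv := fun z => by simp } : ℤ × ℤ ≃ ℤ × ℤ)).2 hsum
      refine this.congr fun z => ?_
      simp only [Function.comp, Equiv.coe_fn_mk]
      have : x ^ z.2 = x ^ z.1 * x ^ (z.2 - z.1) := by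
        rw [← zpow_add₀ hx0]; congr 1; ring
      rw [this]; ring
    simp only [HDagger.coeff_mul, HDagger.conv, ← tsum_mul_right]
    rw [Summable.tsum_comm (f := fun i k => f.coeff i * g.coeff (k - i) * x ^ k) hS]
    refine tsum_congr fun i => ?_
    rw [← (Equiv.addRight i).tsum_eq]
    refine tsum_congr fun k => ?_
    simp only [Equiv.coe_addRight, add_sub_cancel_right]
    rw [zpow_add₀ hx0]; ring

theorem HDagger.evalHom_apply (x : K) (hx : ‖x‖ = 1) (f : HDagger K) :
    HDagger.evalHom x hx f = laurentEval f.coeff x := rfl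

theorem norm_smul_eq_one (u : unitDisk K) {x : K} (hx : ‖x‖ = 1) : ‖((u : Kˣ) : K) * x‖ = 1 := by
  rw [norm_mul, norm_eq_one_of_mem_unitDisk, hx, one_mul]

theorem HDagger.evalHom_sigmaHom (u : unitDisk K) (x : K) (hx : ‖x‖ = 1) (f : HDagger K) :
    HDagger.evalHom x hx (sigmaHom u f) =
      HDagger.evalHom (((u : Kˣ) : K) * x) (norm_smul_eq_one u hx) f := by
  simp only [HDagger.evalHom_apply, laurentEval, sigmaHom, RingHom.coe_mk, MonoidHom.coe_mk,
    OneHom.coe_mk]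
  exact tsum_congr fun k => by rw [mul_zpow]; ring

/-- The binomial series of `(1 + z) ^ k` for an integer `k`. -/
theorem exists_zpow_series (k : ℤ) : ∃ c : PowerSeries K,
    (∀ r : ℝ, 0 ≤ r → r < 1 → GaussBound c r 1) ∧
      ∀ z : K, ‖z‖ < 1 → seriesEval c z = (1 + z) ^ k := by
  have key : ∀ c : PowerSeries K, (∀ r : ℝ, 0 ≤ r → r < 1 → GaussBound c r 1) → ∀ n : ℕ,
      (∀ r : ℝ, 0 ≤ r → r < 1 → GaussBound (c ^ n) r 1) ∧
      ∀ z : K, ‖z‖ < 1 → seriesEval (c ^ n) z = seriesEval c z ^ n := by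
    refine fun c hc n => ⟨fun r h0 h1 => by simpa using (hc r h0 h1).pow h0 n, fun z hz => ?_⟩
    obtain ⟨r, h1, h2⟩ := exists_between hz
    exact seriesEval_pow (hc r ((norm_nonneg _).trans h1.le) h2) h1 n
  have h1 : ∀ r : ℝ, 0 ≤ r → r < 1 → GaussBound (1 + PowerSeries.X : PowerSeries K) r 1 :=
    fun r h0 h1 => (GaussBound.one r).add h0 ((GaussBound.X h0).mono h1.le)
  have e1 : ∀ z : K, ‖z‖ < 1 → seriesEval (1 + PowerSeries.X : PowerSeries K) z = 1 + z := by
    intro z hz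
    obtain ⟨r, h1, h2⟩ := exists_between hz
    rw [seriesEval_add (GaussBound.one r) (GaussBound.X ((norm_nonneg _).trans h1.le)) h1,
      seriesEval_one, seriesEval_X]
  -- For negative exponents, powers of the geometric series for (1+z)^{-1} are used, which avoids
  -- estimating binomial coefficients.
  let V : PowerSeries K := PowerSeries.mk fun n => (-1) ^ n
  have hV : ∀ r : ℝ, 0 ≤ r → r < 1 → GaussBound V r 1 := fun r h0 h1 m => by
    simpa [V] using pow_le_one₀ h0 h1.le
  have eV : ∀ z : K, ‖z‖ < 1 → seriesEval V z = (1 + z)⁻¹ := by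
    intro z hz
    have : ‖-z‖ < 1 := by rwa [norm_neg]
    have h := tsum_geometric_of_norm_lt_one this
    rw [sub_neg_eq_add] at h
    rw [← h]
    exact tsum_congr fun n => by simp [V, neg_pow z n]
  rcases Int.eq_nat_or_neg k with ⟨n, rfl | rfl⟩
  · exact ⟨_, (key _ h1 n).1, fun z hz => by rw [(key _ h1 n).2 z hz, e1 z hz, zpow_natCast]⟩
  · exact ⟨_, (key _ hV n).1, fun z hz => by
      rw [(key _ hV n).2 z hz, eV z hz, zpow_neg, zpow_natCast, inv_pow]⟩

/-- Each u^k = (1 + (u-1))^k has Gauss norms at most 1 on smaller discs, so the sum converges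
because a_k x^k tends to zero. -/
theorem isDiscAnalytic_laurentEval {a : ℤ → K} (ha : Tendsto a cofinite (𝓝 0)) {x : K}
    (hx : ‖x‖ = 1) : IsDiscAnalytic fun u : unitDisk K => laurentEval a (((u : Kˣ) : K) * x) := by
  choose c hc he using exists_zpow_series (K := K)
  have key := isDiscAnalytic_tsum (fun k => PowerSeries.C (a k * x ^ k) * c k) fun r h0 h1 =>
    ⟨fun k => ‖a k * x ^ k‖ * 1, by simpa using (tendsto_mul_zpow ha hx).norm,
      fun k => (GaussBound.C _ _).mul h0 (hc k r h0 h1)⟩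
  refine (congrArg IsDiscAnalytic (funext fun u => ?_)).mpr key
  refine tsum_congr fun k => ?_
  obtain ⟨r, h1, h2⟩ := exists_between (norm_sub_one_lt u)
  rw [seriesEval_mul (GaussBound.C _ r) (hc k r ((norm_nonneg _).trans h1.le) h2) h1, seriesEval_C,
    he k _ (norm_sub_one_lt u), add_sub_cancel, mul_zpow]
  ring

end LaurentSeries

/-! ### Zeros of Laurent series on the unit circle. -/

section IdentityTheorem

variable {K : Type*} [NormedField K] [IsUltrametricDist K] [CompleteSpace K]

theorem finite_le_norm {α : Type*} {f : α → K} (hf : Tendsto f cofinite (𝓝 0)) {δ : ℝ}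
    (hδ : 0 < δ) : {i | δ ≤ ‖f i‖}.Finite := by
  have h : {i | ¬ dist (f i) 0 < δ}.Finite := Metric.tendsto_nhds.1 hf δ hδ
  simpa [dist_zero_right] using h

/-- Strictness survives the infinite sum: only finitely many terms reach C/2, so the terms have a
common bound below C. -/
theorem norm_tsum_lt_of_lt {α : Type*} {f : α → K} (hf : Tendsto f cofinite (𝓝 0)) {C : ℝ}
    (hC : 0 < C) (h : ∀ i, ‖f i‖ < C) : ‖∑' i, f i‖ < C := by
  have hfin : {i | ¬ ‖f i‖ < C / 2}.Finite := by
    simpa using finite_le_norm hf (half_pos hC)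
  obtain ⟨B, hB, hB0, hBC⟩ : ∃ B, (∀ i, ‖f i‖ ≤ B) ∧ 0 ≤ B ∧ B < C := by
    rcases Set.eq_empty_or_nonempty {i | ¬ ‖f i‖ < C / 2} with he | hne
    · refine ⟨C / 2, fun i => ?_, by linarith, by linarith⟩
      by_contra hi
      exact (Set.eq_empty_iff_forall_notMem.1 he i) fun h => hi h.le
    · obtain ⟨j, hj, hmax⟩ := Set.exists_max_image _ (fun i => ‖f i‖) hfin hne
      refine ⟨‖f j‖, fun i => ?_, norm_nonneg _, h j⟩
      by_cases hi : ‖f i‖ < C / 2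
      · exact hi.le.trans (not_lt.1 hj)
      · exact hmax i hi
  exact (norm_tsum_le_of_le hB0 hB).trans_lt hBC

/-- The quotient of the Laurent series with coefficients `a` by `T - x`. -/
noncomputable def divLinear (a : ℤ → K) (x : K) (k : ℤ) : K :=
  ∑' i : ℤ, if k < i then a i * x ^ (i - k - 1) else 0

section DivLinear

variable {a : ℤ → K} {x : K}

theorem tendsto_ite_mul_zpow (ha : Tendsto a cofinite (𝓝 0)) (hx : ‖x‖ = 1) (P : ℤ → Prop)
    [DecidablePred P] (k : ℤ) :
    Tendsto (fun i => if P i then a i * x ^ (i - k - 1) else 0) cofinite (𝓝 0) := by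
  refine squeeze_zero_norm (fun i => ?_) (tendsto_zero_iff_norm_tendsto_zero.1 ha)
  split_ifs <;> simp [hx]

/-- This is (T - x)·`divLinear a x` = a read on coefficients; it does not need x to be a zero. -/
theorem divLinear_rec (ha : Tendsto a cofinite (𝓝 0)) (hx : ‖x‖ = 1) (k : ℤ) :
    divLinear a x (k - 1) = a k + x * divLinear a x k := by
  have hx0 : x ≠ 0 := norm_ne_zero_iff.1 (by rw [hx]; exact one_ne_zero)
  unfold divLinear
  rw [← tsum_mul_left, ← tsum_ite_eq k (fun i => a i), ← Summable.tsum_add]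
  · refine tsum_congr fun i => ?_
    rcases lt_trichotomy i k with h | h | h
    · rw [if_neg (by omega), if_neg (by omega), if_neg (by omega)]; simp
    · subst h; simp
    · rw [if_pos (by omega), if_neg (by omega), if_pos h, zero_add,
        show i - (k - 1) - 1 = (i - k - 1) + 1 by ring, zpow_add_one₀ hx0]
      ring
  · exact (hasSum_ite_eq k (a k)).summable.congr fun i => by
      split_ifs with h
      · rw [h]
      · rfl
  · exact (summable_of_tendsto_zero (tendsto_ite_mul_zpow ha hx _ k)).mul_left x

/-- The parts i > k and i ≤ k add up to x^{-k-1} times the value at x, which is 0. The second form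
controls the quotient as k → -∞, the definition as k → +∞. -/
theorem divLinear_eq_neg (ha : Tendsto a cofinite (𝓝 0)) (hx : ‖x‖ = 1)
    (h0 : laurentEval a x = 0) (k : ℤ) :
    divLinear a x k = -∑' i : ℤ, if i ≤ k then a i * x ^ (i - k - 1) else 0 := by
  have hx0 : x ≠ 0 := norm_ne_zero_iff.1 (by rw [hx]; exact one_ne_zero)
  rw [eq_neg_iff_add_eq_zero]
  unfold divLinear
  rw [← (summable_of_tendsto_zero (tendsto_ite_mul_zpow ha hx _ k)).tsum_add
    (summable_of_tendsto_zero (tendsto_ite_mul_zpow ha hx _ k))]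
  have : ∀ i : ℤ, ((if k < i then a i * x ^ (i - k - 1) else 0) +
      if i ≤ k then a i * x ^ (i - k - 1) else 0) = a i * x ^ i * x ^ (-k - 1) := by
    intro i
    have : a i * x ^ i * x ^ (-k - 1) = a i * x ^ (i - k - 1) := by
      rw [mul_assoc, ← zpow_add₀ hx0]; congr 2; ring
    rw [this]
    split_ifs <;> first | omega | simp
  simp only [this]
  rw [tsum_mul_right]
  unfold laurentEval at h0
  rw [h0, zero_mul]

theorem norm_divLinear_le_of_gt (hx : ‖x‖ = 1) {C : ℝ} (hC : 0 ≤ C) {k : ℤ}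
    (h : ∀ i, k < i → ‖a i‖ ≤ C) : ‖divLinear a x k‖ ≤ C := by
  refine norm_tsum_le_of_le hC fun i => ?_
  split_ifs with hi
  · simpa [hx] using h i hi
  · simpa using hC

theorem norm_divLinear_lt_of_gt (ha : Tendsto a cofinite (𝓝 0)) (hx : ‖x‖ = 1) {C : ℝ}
    (hC : 0 < C) {k : ℤ} (h : ∀ i, k < i → ‖a i‖ < C) : ‖divLinear a x k‖ < C := by
  refine norm_tsum_lt_of_lt (tendsto_ite_mul_zpow ha hx _ k) hC fun i => ?_
  split_ifs with hi
  · simpa [hx] using h i hi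
  · simpa using hC

theorem norm_divLinear_lt_of_le (ha : Tendsto a cofinite (𝓝 0)) (hx : ‖x‖ = 1)
    (h0 : laurentEval a x = 0) {C : ℝ} (hC : 0 < C) {k : ℤ} (h : ∀ i ≤ k, ‖a i‖ < C) :
    ‖divLinear a x k‖ < C := by
  rw [divLinear_eq_neg ha hx h0, norm_neg]
  refine norm_tsum_lt_of_lt (tendsto_ite_mul_zpow ha hx _ k) hC fun i => ?_
  split_ifs with hi
  · simpa [hx] using h i hi
  · simpa using hC

theorem tendsto_divLinear (ha : Tendsto a cofinite (𝓝 0)) (hx : ‖x‖ = 1)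
    (h0 : laurentEval a x = 0) : Tendsto (divLinear a x) cofinite (𝓝 0) := by
  rw [Metric.tendsto_nhds]
  intro δ hδ
  have hfin : {i | ¬ ‖a i‖ < δ}.Finite := by
    simpa using finite_le_norm ha hδ
  obtain ⟨A, hA⟩ := hfin.bddAbove
  obtain ⟨B, hB⟩ := hfin.bddBelow
  refine ((Set.finite_Icc B A).subset ?_ : {k | ¬ dist (divLinear a x k) 0 < δ}.Finite)
  intro k hk
  simp only [Set.mem_ofPred_eq, dist_zero_right] at hk
  constructor
  · by_contra hlt
    refine hk (norm_divLinear_lt_of_le ha hx h0 hδ fun i hi => ?_)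
    by_contra hi'
    have := hB hi'
    omega
  · by_contra hlt
    refine hk (norm_divLinear_lt_of_gt ha hx hδ fun i hi => ?_)
    by_contra hi'
    have := hA hi'
    omega

theorem laurentEval_divLinear (ha : Tendsto a cofinite (𝓝 0)) (hx : ‖x‖ = 1)
    (h0 : laurentEval a x = 0) {y : K} (hy : ‖y‖ = 1) :
    (y - x) * laurentEval (divLinear a x) y = laurentEval a y := by
  have hy0 : y ≠ 0 := norm_ne_zero_iff.1 (by rw [hy]; exact one_ne_zero)
  have hs := summable_mul_zpow (tendsto_divLinear ha hx h0) hy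
  have h1 : y * laurentEval (divLinear a x) y = ∑' k : ℤ, divLinear a x (k - 1) * y ^ k := by
    unfold laurentEval
    rw [← tsum_mul_left, ← (Equiv.subRight (1 : ℤ)).tsum_eq]
    refine tsum_congr fun k => ?_
    rw [Equiv.subRight_apply]
    rw [zpow_sub_one₀ hy0]
    field_simp
  rw [sub_mul, h1]
  have h2 : ∀ k, divLinear a x (k - 1) * y ^ k =
      a k * y ^ k + x * (divLinear a x k * y ^ k) := fun k => by
    rw [divLinear_rec ha hx]; ring
  simp only [h2]
  rw [(summable_mul_zpow ha hy).tsum_add (hs.mul_left x), tsum_mul_left]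
  unfold laurentEval
  ring

end DivLinear

/-- A Laurent series whose largest coefficients have indices in an interval of length `n` has at
most `n` zeros on the unit circle. -/
theorem card_zeros_le (n : ℕ) : ∀ (a : ℤ → K) (t : ℤ) (Z : Finset K),
    Tendsto a cofinite (𝓝 0) → a t ≠ 0 → (∀ k, ‖a k‖ ≤ ‖a t‖) → (∀ k, t < k → ‖a k‖ < ‖a t‖) →
    (∀ k, k < t - n → ‖a k‖ < ‖a t‖) → (∀ x ∈ Z, ‖x‖ = 1 ∧ laurentEval a x = 0) → Z.card ≤ n := by
  classical
  induction n with
  | zero =>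
    intro a t Z ha ht _ hgt hlt hZ
    rw [Nat.le_zero, Finset.card_eq_zero, Finset.eq_empty_iff_forall_notMem]
    intro x hxZ
    obtain ⟨hx, h0⟩ := hZ x hxZ
    unfold laurentEval at h0
    -- With a single dominant coefficient, the term a_t x^t is strictly larger than the sum of all
    -- others and cannot be cancelled.
    rw [(summable_mul_zpow ha hx).tsum_eq_add_tsum_ite t] at h0
    have hpos : 0 < ‖a t‖ := norm_pos_iff.2 ht
    have : ‖∑' k, if k = t then 0 else a k * x ^ k‖ < ‖a t‖ := by
      refine norm_tsum_lt_of_lt ?_ hpos fun k => ?_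
      · refine squeeze_zero_norm (fun k => ?_) (a := fun k => ‖a k‖) (by simpa using ha.norm)
        split_ifs <;> simp [hx]
      · split_ifs with hk
        · simpa using hpos
        · rw [norm_mul, norm_zpow, hx, one_zpow, mul_one]
          rcases lt_or_gt_of_ne hk with h | h
          · exact hlt k (by simpa using h)
          · exact hgt k h
    rw [← norm_neg, ← eq_neg_of_add_eq_zero_left h0] at this
    simp [hx] at this
  | succ n ih =>
    intro a t Z ha ht hle hgt hlt hZ
    rcases Z.eq_empty_or_nonempty with rfl | ⟨x, hxZ⟩
    · simp
    obtain ⟨hx, h0⟩ := hZ x hxZ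
    have hpos : 0 < ‖a t‖ := norm_pos_iff.2 ht
    -- Division by T - x keeps the maximal norm and moves its last index from t to t - 1. The lower
    -- end stays put, as t - (n + 1) = (t - 1) - n, so the interval shortens by one.
    have hbt : ‖divLinear a x t‖ < ‖a t‖ := norm_divLinear_lt_of_gt ha hx hpos hgt
    have hb : ‖divLinear a x (t - 1)‖ = ‖a t‖ := by
      rw [divLinear_rec ha hx]
      have h1 : ‖x * divLinear a x t‖ < ‖a t‖ := by rwa [norm_mul, hx, one_mul]
      rw [IsUltrametricDist.norm_add_eq_max_of_norm_ne_norm h1.ne', max_eq_left h1.le]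
    have := ih (divLinear a x) (t - 1) (Z.erase x) (tendsto_divLinear ha hx h0) ?_ ?_ ?_ ?_ ?_
    · rw [Finset.card_erase_of_mem hxZ] at this; omega
    · exact norm_pos_iff.1 (by rw [hb]; exact hpos)
    · intro k
      rw [hb]
      exact norm_divLinear_le_of_gt hx hpos.le fun i _ => hle i
    · intro k hk
      rw [hb]
      exact norm_divLinear_lt_of_gt ha hx hpos fun i hi => hgt i (by omega)
    · intro k hk
      rw [hb]
      refine norm_divLinear_lt_of_le ha hx h0 hpos fun i hi => hlt i ?_
      push_cast
      omega
    · intro y hy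
      obtain ⟨hyx, hyZ⟩ := Finset.mem_erase.1 hy
      obtain ⟨hy1, hy0⟩ := hZ y hyZ
      have h := laurentEval_divLinear ha hx h0 hy1
      rw [hy0] at h
      exact ⟨hy1, (mul_eq_zero.1 h).resolve_left (sub_ne_zero.2 hyx)⟩

/-- A Laurent series with coefficients tending to zero that vanishes on the unit circle of a
nontrivially valued field is zero. -/
theorem eq_zero_of_laurentEval_eq_zero {c : K} (hc0 : c ≠ 0) (hc : ‖c‖ < 1) {a : ℤ → K}
    (ha : Tendsto a cofinite (𝓝 0)) (h : ∀ x : K, ‖x‖ = 1 → laurentEval a x = 0) : a = 0 := by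
  classical
  by_contra hne
  obtain ⟨j, hj⟩ : ∃ j, a j ≠ 0 := by
    by_contra hall
    push Not at hall
    exact hne (funext hall)
  have hpos : 0 < ‖a j‖ := norm_pos_iff.2 hj
  have hfin : ∀ δ : ℝ, 0 < δ → {i | δ ≤ ‖a i‖}.Finite := fun δ hδ => finite_le_norm ha hδ
  obtain ⟨i, hi, himax⟩ := Set.exists_max_image _ (fun i => ‖a i‖) (hfin _ hpos) ⟨j, le_refl ‖a j‖⟩
  have hmax : ∀ k, ‖a k‖ ≤ ‖a i‖ := fun k => by
    by_cases hk : ‖a j‖ ≤ ‖a k‖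
    · exact himax k hk
    · exact (not_le.1 hk).le.trans hi
  have hipos : 0 < ‖a i‖ := hpos.trans_le hi
  -- The maximal norm is attained at finitely many indices: t is the last of them, s below bounds
  -- them from below, so at most t - s zeros are possible.
  obtain ⟨t, ht, htmax⟩ := Set.exists_max_image _ id (hfin _ hipos) ⟨i, le_refl ‖a i‖⟩
  obtain ⟨s, hs⟩ := (hfin _ hipos).bddBelow
  have hti : ‖a t‖ = ‖a i‖ := le_antisymm (hmax t) ht
  -- The points 1 + c^{l+1} provide arbitrarily many distinct zeros on the circle.
  have hinj : Function.Injective fun l : ℕ => 1 + c ^ (l + 1) := by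
    intro l m hlm
    have h1 : ‖c‖ ^ (l + 1) = ‖c‖ ^ (m + 1) := by
      rw [← norm_pow, ← norm_pow, add_left_cancel hlm]
    have := pow_right_injective₀ (norm_pos_iff.2 hc0) hc.ne h1
    omega
  have := card_zeros_le (t - s).toNat a t
    ((Finset.range ((t - s).toNat + 1)).image fun l : ℕ => 1 + c ^ (l + 1)) ha
    (norm_pos_iff.1 (by rw [hti]; exact hipos)) (by rw [hti]; exact hmax) ?_ ?_ ?_
  · rw [Finset.card_image_of_injective _ hinj, Finset.card_range] at this
    omega
  · intro k hk
    rw [hti]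
    by_contra hk'
    have : k ≤ t := htmax k (not_lt.1 hk')
    omega
  · intro k hk
    rw [hti]
    by_contra hk'
    have : s ≤ k := hs (not_lt.1 hk')
    omega
  · intro x hx
    obtain ⟨l, _, rfl⟩ := Finset.mem_image.1 hx
    have hl : ‖c ^ (l + 1)‖ < 1 := by
      rw [norm_pow]; exact pow_lt_one₀ (norm_nonneg _) hc (by omega)
    have hone : ‖1 + c ^ (l + 1)‖ = 1 := by
      rw [IsUltrametricDist.norm_add_eq_max_of_norm_ne_norm (by rw [norm_one]; exact hl.ne'),
        norm_one, max_eq_left hl.le]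
    exact ⟨hone, h _ hone⟩

theorem eq_of_laurentEval_eq {c : K} (hc0 : c ≠ 0) (hc : ‖c‖ < 1) {a b : ℤ → K}
    (ha : Tendsto a cofinite (𝓝 0)) (hb : Tendsto b cofinite (𝓝 0))
    (h : ∀ x : K, ‖x‖ = 1 → laurentEval a x = laurentEval b x) : a = b := by
  refine sub_eq_zero.1 (eq_zero_of_laurentEval_eq_zero hc0 hc (a := a - b) ?_ fun x hx => ?_)
  · rw [← sub_zero (0 : K)]; exact ha.sub hb
  · have := h x hx
    unfold laurentEval at this ⊢
    simp only [Pi.sub_apply, sub_mul]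
    rw [(summable_mul_zpow ha hx).tsum_sub (summable_mul_zpow hb hx), this, sub_self]

theorem HDagger.ext_eval {c : K} (hc0 : c ≠ 0) (hc : ‖c‖ < 1) {f g : HDagger K}
    (h : ∀ (x : K) (hx : ‖x‖ = 1), HDagger.evalHom x hx f = HDagger.evalHom x hx g) : f = g :=
  HDagger.ext (eq_of_laurentEval_eq hc0 hc f.tendsto_coeff g.tendsto_coeff h)

end IdentityTheorem

/-! ### Norms of integers, p-power maps and q-factorials. -/

section Arithmetic

variable {K : Type*} [NormedField K] [IsUltrametricDist K] {p : ℕ} [hpp : Fact p.Prime]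

theorem norm_natCast_eq_one_of_not_dvd (hp : ‖(p : K)‖ < 1) {m : ℕ} (hm : ¬ p ∣ m) :
    ‖(m : K)‖ = 1 := by
  refine le_antisymm (IsUltrametricDist.norm_natCast_le_one K m) ?_
  by_contra hlt
  rw [not_le] at hlt
  have hcop : IsCoprime (p : ℤ) (m : ℤ) :=
    Nat.isCoprime_iff_coprime.2 ((Nat.Prime.coprime_iff_not_dvd hpp.out).2 hm)
  obtain ⟨a, b, hab⟩ := hcop
  have h1 : (a : K) * p + b * m = 1 := by exact_mod_cast congrArg (Int.cast : ℤ → K) hab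
  have h2 : ‖(a : K) * p + b * m‖ < 1 := by
    refine (IsUltrametricDist.norm_add_le_max _ _).trans_lt (max_lt ?_ ?_)
    · rw [norm_mul]
      exact mul_lt_one_of_nonneg_of_lt_one_right (IsUltrametricDist.norm_intCast_le_one K a)
        (norm_nonneg _) hp
    · rw [norm_mul]
      exact mul_lt_one_of_nonneg_of_lt_one_right (IsUltrametricDist.norm_intCast_le_one K b)
        (norm_nonneg _) hlt
  rw [h1, norm_one] at h2
  exact lt_irrefl _ h2

theorem norm_natCast_eq_pow (hp : ‖(p : K)‖ < 1) {l : ℕ} (hl : l ≠ 0) :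
    ‖(l : K)‖ = ‖(p : K)‖ ^ padicValNat p l := by
  obtain ⟨m', hm', hlm'⟩ : ∃ m', ¬ p ∣ m' ∧ l = p ^ padicValNat p l * m' := by
    refine ⟨l / p ^ padicValNat p l, ?_, ?_⟩
    · rw [← Nat.factorization_def l hpp.out]
      exact Nat.not_dvd_ordCompl hpp.out hl
    · exact (Nat.mul_div_cancel' pow_padicValNat_dvd).symm
  conv_lhs => rw [hlm']
  rw [Nat.cast_mul, Nat.cast_pow, norm_mul, norm_pow, norm_natCast_eq_one_of_not_dvd hp hm', mul_one]

theorem norm_pow_pred_le_norm_natCast (hp : ‖(p : K)‖ < 1) (k : ℕ) :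
    ‖(p : K)‖ ^ k ≤ ‖((k + 1 : ℕ) : K)‖ := by
  rw [norm_natCast_eq_pow hp k.succ_ne_zero]
  refine pow_le_pow_of_le_one (norm_nonneg _) hp.le ?_
  have h1 : p ^ padicValNat p (k + 1) ≤ k + 1 := Nat.le_of_dvd k.succ_pos pow_padicValNat_dvd
  have h2 : padicValNat p (k + 1) < p ^ padicValNat p (k + 1) :=
    Nat.lt_pow_self hpp.out.one_lt
  rw [Nat.succ_eq_add_one]
  omega

theorem norm_pow_le_norm_factorial [CharZero K] (hp : ‖(p : K)‖ < 1) (k : ℕ) :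
    ‖(p : K)‖ ^ k ≤ ‖((k.factorial : ℕ) : K)‖ := by
  rw [norm_natCast_eq_pow hp k.factorial_ne_zero]
  exact pow_le_pow_of_le_one (norm_nonneg _) hp.le (padicValNat_factorial_le p k)

/-- Freshman's dream with an error term. -/
theorem norm_one_add_pow_sub_le (y : K) (hy : ‖y‖ ≤ 1) :
    ‖(1 + y) ^ p - 1 - y ^ p‖ ≤ ‖(p : K)‖ * ‖y‖ := by
  obtain ⟨n, hn⟩ : ∃ n, p = n + 1 := ⟨p - 1, by have := hpp.out.pos; omega⟩
  have h : (1 + y) ^ p - 1 - y ^ p =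
      ∑ i ∈ Finset.range n, y ^ (i + 1) * ((p.choose (i + 1) : ℕ) : K) := by
    rw [add_comm, add_pow, Finset.sum_range_succ, hn, Finset.sum_range_succ']
    simp
    ring
  rw [h]
  refine IsUltrametricDist.norm_sum_le_of_forall_le_of_nonneg (by positivity) fun i hi => ?_
  have hi' := Finset.mem_range.1 hi
  obtain ⟨m, hm⟩ := hpp.out.dvd_choose_self (k := i + 1) (by omega) (by omega)
  rw [hm, norm_mul, norm_pow, Nat.cast_mul, norm_mul, pow_succ]
  have h1 := IsUltrametricDist.norm_natCast_le_one K m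
  have h2 : ‖y‖ ^ i ≤ 1 := pow_le_one₀ (norm_nonneg _) hy
  calc ‖y‖ ^ i * ‖y‖ * (‖(p : K)‖ * ‖(m : K)‖)
      = (‖y‖ ^ i * ‖(m : K)‖) * (‖(p : K)‖ * ‖y‖) := by ring
    _ ≤ 1 * (‖(p : K)‖ * ‖y‖) := by
      refine mul_le_mul_of_nonneg_right ?_ (by positivity)
      exact mul_le_one₀ h2 (norm_nonneg _) h1
    _ = _ := one_mul _

/-- Modulo an error p(x-1), x^p - 1 is (x-1)^p. The p-th power thus contracts the disc towards 1,
which yields q^{p^n} → 1. -/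
theorem norm_pow_prime_sub_one_le {x : K} (hx : ‖x - 1‖ ≤ 1) :
    ‖x ^ p - 1‖ ≤ ‖x - 1‖ * max ‖x - 1‖ ‖(p : K)‖ := by
  have h := norm_one_add_pow_sub_le (p := p) (x - 1) hx
  rw [add_sub_cancel] at h
  have h2 : ‖(x - 1) ^ p‖ ≤ ‖x - 1‖ * ‖x - 1‖ := by
    rw [norm_pow, ← pow_two]
    exact pow_le_pow_of_le_one (norm_nonneg _) hx hpp.out.two_le
  have h3 : x ^ p - 1 = (x ^ p - 1 - (x - 1) ^ p) + (x - 1) ^ p := by ring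
  rw [h3, mul_max_of_nonneg _ _ (norm_nonneg _)]
  refine (IsUltrametricDist.norm_add_le_max _ _).trans (max_le ?_ ?_)
  · exact h.trans (le_max_of_le_right (mul_comm _ _).le)
  · exact h2.trans (le_max_left _ _)

/-- The p-th power map is injective on the residue field, of characteristic p: x^p - 1 and (x-1)^p
have the same reduction. -/
theorem norm_sub_one_lt_of_pow (hp : ‖(p : K)‖ < 1) {x : K} (hx : ‖x‖ ≤ 1)
    (h : ‖x ^ p - 1‖ < 1) : ‖x - 1‖ < 1 := by
  have hx1 : ‖x - 1‖ ≤ 1 := by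
    have := IsUltrametricDist.norm_add_le_max x (-1)
    rw [norm_neg, norm_one, ← sub_eq_add_neg] at this
    exact this.trans (max_le hx le_rfl)
  have h1 := norm_one_add_pow_sub_le (p := p) (x - 1) hx1
  rw [add_sub_cancel] at h1
  have h2 : ‖(x - 1) ^ p‖ < 1 := by
    have h3 : (x - 1) ^ p = (x ^ p - 1) + -(x ^ p - 1 - (x - 1) ^ p) := by ring
    rw [h3]
    refine (IsUltrametricDist.norm_add_le_max _ _).trans_lt (max_lt h ?_)
    rw [norm_neg]
    exact (h1.trans (mul_le_of_le_one_right (norm_nonneg _) hx1)).trans_lt hp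
  rw [norm_pow] at h2
  by_contra hge
  exact absurd (one_le_pow₀ (not_lt.1 hge)) (not_le.2 h2)

theorem norm_pow_prime_pow_sub_one_le {x : K} {θ : ℝ} (hθ : θ ≤ 1) (hx : ‖x - 1‖ ≤ θ)
    (hp : ‖(p : K)‖ ≤ θ) (n : ℕ) : ‖x ^ p ^ n - 1‖ ≤ θ ^ (n + 1) := by
  have h0 : 0 ≤ θ := (norm_nonneg _).trans hx
  induction n with
  | zero => simpa using hx
  | succ n ih =>
    rw [pow_succ, pow_mul, pow_succ θ]
    refine (norm_pow_prime_sub_one_le (ih.trans (pow_le_one₀ h0 hθ))).trans ?_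
    refine mul_le_mul ih (max_le (ih.trans ?_) hp) (by positivity) (by positivity)
    exact pow_le_of_le_one h0 hθ n.succ_ne_zero

theorem tendsto_pow_prime_pow (hp : ‖(p : K)‖ < 1) {x : K} (hx : ‖x - 1‖ < 1) :
    Tendsto (fun n => x ^ p ^ n) atTop (𝓝 1) := by
  rw [tendsto_iff_norm_sub_tendsto_zero]
  have hθ : max ‖x - 1‖ ‖(p : K)‖ < 1 := max_lt hx hp
  refine squeeze_zero (fun _ => norm_nonneg _)
    (norm_pow_prime_pow_sub_one_le hθ.le (le_max_left _ _) (le_max_right _ _)) ?_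
  exact (tendsto_add_atTop_iff_nat 1).2
    (tendsto_pow_atTop_nhds_zero_of_lt_one (le_max_of_le_left (norm_nonneg _)) hθ)

/-- The linear term l·y dominates the binomial expansion. Indeed j·C(l,j) = l·C(l-1,j-1) and |j| ≥
|p|^{j-1}, so for |y| < |p| each term of degree j ≥ 2 is smaller by a factor θ = |y|/|p|. -/
theorem norm_natCast_mul_le_norm_pow_sub_one [CharZero K] (hp : ‖(p : K)‖ < 1) {y : K}
    (hy : ‖y‖ < ‖(p : K)‖) (l : ℕ) : ‖(l : K)‖ * ‖y‖ ≤ ‖(1 + y) ^ l - 1‖ := by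
  rcases l with _ | l
  · simp
  have hp0 : 0 < ‖(p : K)‖ := norm_pos_iff.2 (Nat.cast_ne_zero.2 hpp.out.ne_zero)
  set θ := ‖y‖ / ‖(p : K)‖ with hθ
  have hθ0 : 0 ≤ θ := by positivity
  have hθ1 : θ < 1 := (div_lt_one hp0).2 hy
  have hy1 : ‖y‖ = θ * ‖(p : K)‖ := by rw [hθ]; field_simp
  have h : (1 + y) ^ (l + 1) - 1 = ((l + 1 : ℕ) : K) * y +
      ∑ i ∈ Finset.range l, y ^ (i + 2) * (((l + 1).choose (i + 2) : ℕ) : K) := by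
    rw [add_comm 1 y, add_pow, Finset.sum_range_succ', Finset.sum_range_succ']
    simp
    ring
  have hsum : ‖∑ i ∈ Finset.range l, y ^ (i + 2) * (((l + 1).choose (i + 2) : ℕ) : K)‖ ≤
      θ * (‖((l + 1 : ℕ) : K)‖ * ‖y‖) := by
    refine IsUltrametricDist.norm_sum_le_of_forall_le_of_nonneg (by positivity) fun i hi => ?_
    have hc : ‖((i + 2 : ℕ) : K)‖ * ‖(((l + 1).choose (i + 2) : ℕ) : K)‖ ≤
        ‖((l + 1 : ℕ) : K)‖ := by
      rw [← norm_mul, ← Nat.cast_mul, mul_comm, ← Nat.add_one_mul_choose_eq l (i + 1),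
        Nat.cast_mul, norm_mul]
      exact mul_le_of_le_one_right (norm_nonneg _) (IsUltrametricDist.norm_natCast_le_one K _)
    have hk := norm_pow_pred_le_norm_natCast hp (i + 1)
    have hpos : 0 < ‖((i + 2 : ℕ) : K)‖ := norm_pos_iff.2 (Nat.cast_ne_zero.2 (by omega))
    have h1 : ‖y‖ ^ (i + 1) ≤ θ * ‖((i + 2 : ℕ) : K)‖ := by
      rw [hy1, mul_pow]
      exact mul_le_mul (pow_le_of_le_one hθ0 hθ1.le i.succ_ne_zero) hk (by positivity) hθ0
    rw [norm_mul, norm_pow]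
    refine le_of_mul_le_mul_left ?_ hpos
    calc ‖((i + 2 : ℕ) : K)‖ * (‖y‖ ^ (i + 2) * ‖(((l + 1).choose (i + 2) : ℕ) : K)‖)
        = (‖((i + 2 : ℕ) : K)‖ * ‖(((l + 1).choose (i + 2) : ℕ) : K)‖) *
            (‖y‖ ^ (i + 1) * ‖y‖) := by ring
      _ ≤ ‖((l + 1 : ℕ) : K)‖ * (θ * ‖((i + 2 : ℕ) : K)‖ * ‖y‖) := by gcongr
      _ = _ := by ring
  rcases eq_or_ne y 0 with rfl | hy0
  · simp
  have hpos : 0 < ‖((l + 1 : ℕ) : K)‖ * ‖y‖ :=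
    mul_pos (norm_pos_iff.2 (Nat.cast_ne_zero.2 l.succ_ne_zero)) (norm_pos_iff.2 hy0)
  have hlt : ‖∑ i ∈ Finset.range l, y ^ (i + 2) * (((l + 1).choose (i + 2) : ℕ) : K)‖ <
      ‖((l + 1 : ℕ) : K) * y‖ := by
    rw [norm_mul]
    exact hsum.trans_lt (mul_lt_of_lt_one_left hpos hθ1)
  rw [h, IsUltrametricDist.norm_add_eq_max_of_norm_ne_norm hlt.ne', max_eq_left hlt.le, norm_mul]

/-- The `q`-factorials of a `q` that is not a root of unity decrease at most geometrically. -/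
theorem exists_pow_le_norm_prod_pow_sub [CharZero K] (hp : ‖(p : K)‖ < 1) {q : K}
    (hq : ‖q - 1‖ < 1) (hq1 : ∀ m, 0 < m → q ^ m ≠ 1) :
    ∃ c : ℝ, 0 < c ∧ ∀ i k : ℕ,
      c ^ k ≤ ‖∏ j ∈ Finset.range k, (q ^ (i + k) - q ^ (i + j))‖ := by
  have hp0 : 0 < ‖(p : K)‖ := norm_pos_iff.2 (Nat.cast_ne_zero.2 hpp.out.ne_zero)
  have hqn : ‖q‖ = 1 := by
    have h2 := IsUltrametricDist.norm_add_eq_max_of_norm_ne_norm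
      (x := q - 1) (y := 1) (by rw [norm_one]; exact hq.ne)
    rwa [sub_add_cancel, norm_one, max_eq_right hq.le] at h2
  -- A power q^{p^N} is close enough to 1 for the linear-term estimate. It transfers to q because
  -- q^l - 1 divides (q^l)^{p^N} - 1 with integral quotient.
  obtain ⟨N, hN⟩ := ((tendsto_iff_norm_sub_tendsto_zero.1
    (tendsto_pow_prime_pow hp hq)).eventually (gt_mem_nhds hp0)).exists
  set y := q ^ p ^ N - 1 with hy
  have hypos : 0 < ‖y‖ := norm_pos_iff.2 (sub_ne_zero.2 (hq1 _ (pow_pos hpp.out.pos N)))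
  have hl : ∀ l : ℕ, ‖y‖ * ‖(l : K)‖ ≤ ‖q ^ l - 1‖ := by
    intro l
    have h1 := norm_natCast_mul_le_norm_pow_sub_one hp hN l
    rw [hy, add_sub_cancel, ← hy, ← pow_mul, mul_comm (p ^ N), pow_mul] at h1
    have h2 : ∀ (x : K) (n : ℕ), ‖x‖ ≤ 1 → ‖x ^ n - 1‖ ≤ ‖x - 1‖ := fun x n hx => by
      rw [← geom_sum_mul, norm_mul]
      refine mul_le_of_le_one_left (norm_nonneg _) ?_
      refine IsUltrametricDist.norm_sum_le_of_forall_le_of_nonneg zero_le_one fun i _ => ?_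
      rw [norm_pow]; exact pow_le_one₀ (norm_nonneg _) hx
    rw [mul_comm]
    exact h1.trans (h2 _ _ (by rw [norm_pow, hqn, one_pow]))
  -- The product equals ∏|q^{j+1} - 1| over j < k, which is at least |y|^k |k!|, and |k!| ≥ |p|^k.
  refine ⟨‖y‖ * ‖(p : K)‖, by positivity, fun i k => ?_⟩
  have h1 : ‖∏ j ∈ Finset.range k, (q ^ (i + k) - q ^ (i + j))‖ =
      ∏ j ∈ Finset.range k, ‖q ^ (j + 1) - 1‖ := by
    rw [norm_prod, ← Finset.prod_range_reflect]
    refine Finset.prod_congr rfl fun j hj => ?_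
    have hj' := Finset.mem_range.1 hj
    have : q ^ (i + k) - q ^ (i + (k - 1 - j)) = q ^ (i + (k - 1 - j)) * (q ^ (j + 1) - 1) := by
      rw [mul_sub, ← pow_add, mul_one]; congr 2; omega
    rw [this, norm_mul, norm_pow, hqn, one_pow, one_mul]
  rw [h1, mul_pow]
  calc ‖y‖ ^ k * ‖(p : K)‖ ^ k ≤ ‖y‖ ^ k * ‖((k.factorial : ℕ) : K)‖ := by
        gcongr; exact norm_pow_le_norm_factorial hp k
    _ = ∏ j ∈ Finset.range k, ‖y‖ * ‖((j + 1 : ℕ) : K)‖ := by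
      rw [Finset.prod_mul_distrib, Finset.prod_const, Finset.card_range,
        ← Finset.prod_range_add_one_eq_factorial, Nat.cast_prod, norm_prod]
    _ ≤ _ := Finset.prod_le_prod (fun _ _ => by positivity) fun j _ => hl (j + 1)

end Arithmetic

/-! ### Newton interpolation and a three circles estimate. -/

section Newton

variable {K : Type*} [NormedField K] [IsUltrametricDist K] [CompleteSpace K]

open PowerSeries

/-- The coefficients of `x ^ m` in the Newton basis of the nodes `z`. -/
def newtonCoeff (z : ℕ → K) : ℕ → ℕ → K
  | 0, 0 => 1
  | 0, _ + 1 => 0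
  | m + 1, 0 => z 0 * newtonCoeff z m 0
  | m + 1, i + 1 => newtonCoeff z m i + z (i + 1) * newtonCoeff z m (i + 1)

/-- The Newton basis of the nodes `z`. -/
def newtonBasis (z : ℕ → K) (i : ℕ) (x : K) : K := ∏ j ∈ Finset.range i, (x - z j)

variable {z : ℕ → K}

theorem newtonCoeff_eq_zero (m : ℕ) : ∀ i, m < i → newtonCoeff z m i = 0 := by
  induction m with
  | zero => rintro (_ | i) h
            · omega
            · rfl
  | succ m ih =>
    rintro (_ | i) h
    · omega
    · rw [newtonCoeff, ih i (by omega), ih (i + 1) (by omega)]; ring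

theorem newtonBasis_succ (i : ℕ) (x : K) :
    newtonBasis z (i + 1) x = newtonBasis z i x * (x - z i) := Finset.prod_range_succ _ _

/-- Multiplication by x sends the i-th basis polynomial to the next one plus z_i times itself, which
is the recursion of `newtonCoeff`. -/
theorem pow_eq_sum_newtonBasis (x : K) (m : ℕ) :
    x ^ m = ∑ i ∈ Finset.range (m + 1), newtonCoeff z m i * newtonBasis z i x := by
  induction m with
  | zero => simp [newtonCoeff, newtonBasis]
  | succ m ih =>
    have h1 : ∑ i ∈ Finset.range (m + 2), newtonCoeff z (m + 1) i * newtonBasis z i x =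
        ∑ i ∈ Finset.range (m + 1), newtonCoeff z m i * newtonBasis z (i + 1) x +
        ∑ i ∈ Finset.range (m + 2), z i * newtonCoeff z m i * newtonBasis z i x := by
      rw [Finset.sum_range_succ', Finset.sum_range_succ' _ (m + 1), ← add_assoc,
        ← Finset.sum_add_distrib]
      congr 1
      exact Finset.sum_congr rfl fun i _ => by rw [newtonCoeff]; ring
    rw [h1, Finset.sum_range_succ _ (m + 1), newtonCoeff_eq_zero m (m + 1) (by omega), mul_zero,
      zero_mul, add_zero, ← Finset.sum_add_distrib, pow_succ, ih, Finset.sum_mul]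
    exact Finset.sum_congr rfl fun i _ => by rw [newtonBasis_succ]; ring

/-- For i ≤ m, `newtonCoeff z m i` is the complete homogeneous polynomial of degree m - i in z_0, …,
z_i, hence the bound s^{m-i}, written without division. -/
theorem norm_newtonCoeff_mul_le {s : ℝ} (hs0 : 0 ≤ s) (hs : ∀ j, ‖z j‖ ≤ s) (m : ℕ) :
    ∀ i, ‖newtonCoeff z m i‖ * s ^ i ≤ s ^ m := by
  induction m with
  | zero =>
    rintro (_ | i)
    · simp [newtonCoeff]
    · simp [newtonCoeff]
  | succ m ih =>
    rintro (_ | i)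
    · have := ih 0
      simp only [pow_zero, mul_one] at this ⊢
      rw [newtonCoeff, norm_mul, pow_succ, mul_comm]
      exact mul_le_mul this (hs 0) (norm_nonneg _) (by positivity)
    · rw [newtonCoeff]
      refine (mul_le_mul_of_nonneg_right (IsUltrametricDist.norm_add_le_max _ _)
        (by positivity)).trans ?_
      rw [max_mul_of_nonneg _ _ (by positivity)]
      refine max_le ?_ ?_
      · rw [pow_succ, pow_succ, ← mul_assoc]
        exact mul_le_mul_of_nonneg_right (ih i) hs0
      · rw [norm_mul, pow_succ s m, mul_assoc, mul_comm]
        exact mul_le_mul (ih (i + 1)) (hs _) (norm_nonneg _) (by positivity)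

theorem norm_newtonBasis_le {s : ℝ} (hs : ∀ j, ‖z j‖ ≤ s) {x : K} (hx : ‖x‖ ≤ s) (i : ℕ) :
    ‖newtonBasis z i x‖ ≤ s ^ i := by
  unfold newtonBasis
  rw [norm_prod, ← Finset.card_range i, ← Finset.prod_const, Finset.card_range]
  exact Finset.prod_le_prod (fun _ _ => norm_nonneg _) fun j _ =>
    (norm_sub_le_max' _ _).trans (max_le hx (hs j))

theorem newtonBasis_node_eq_zero {i n : ℕ} (h : n < i) : newtonBasis z i (z n) = 0 :=
  Finset.prod_eq_zero (Finset.mem_range.2 h) (sub_self _)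

/-- The coefficients of a convergent power series in the Newton basis of the nodes `z`. -/
noncomputable def newtonSeriesCoeff (z : ℕ → K) (a : PowerSeries K) (i : ℕ) : K :=
  ∑' m, coeff m a * newtonCoeff z m i

/-- Only degrees m ≥ i contribute to the i-th Newton coefficient, and passing from radius r to s
gains (s/r)^m ≤ (s/r)^i. -/
theorem norm_newtonSeriesCoeff_mul_le {a : PowerSeries K} {r s B : ℝ} (hs0 : 0 < s) (hsr : s < r)
    (hs : ∀ j, ‖z j‖ ≤ s) (ha : GaussBound a r B) (i : ℕ) :
    ‖newtonSeriesCoeff z a i‖ * s ^ i ≤ B * (s / r) ^ i := by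
  have hr : 0 < r := hs0.trans hsr
  have hB := ha.nonneg
  rw [← le_div_iff₀ (by positivity)]
  refine norm_tsum_le_of_le (by positivity) fun m => ?_
  rw [le_div_iff₀ (by positivity)]
  rcases lt_or_ge m i with h | h
  · rw [newtonCoeff_eq_zero m i h]; simp only [mul_zero, norm_zero, zero_mul]; positivity
  · have h1 : (s / r) ^ m ≤ (s / r) ^ i :=
      pow_le_pow_of_le_one (by positivity) ((div_le_one hr).2 hsr.le) h
    calc ‖coeff m a * newtonCoeff z m i‖ * s ^ i
        = ‖coeff m a‖ * (‖newtonCoeff z m i‖ * s ^ i) := by rw [norm_mul]; ring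
      _ ≤ ‖coeff m a‖ * s ^ m :=
        mul_le_mul_of_nonneg_left (norm_newtonCoeff_mul_le hs0.le hs m i) (norm_nonneg _)
      _ = ‖coeff m a‖ * r ^ m * (s / r) ^ m := by rw [div_pow]; field_simp
      _ ≤ B * (s / r) ^ m := mul_le_mul_of_nonneg_right (ha m) (by positivity)
      _ ≤ _ := mul_le_mul_of_nonneg_left h1 hB

theorem seriesEval_eq_tsum_newtonBasis {a : PowerSeries K} {r s B : ℝ} (hs0 : 0 < s) (hsr : s < r)
    (hs : ∀ j, ‖z j‖ ≤ s) (ha : GaussBound a r B) {x : K} (hx : ‖x‖ ≤ s) :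
    seriesEval a x = ∑' i, newtonSeriesCoeff z a i * newtonBasis z i x := by
  have hr : 0 < r := hs0.trans hsr
  have hB := ha.nonneg
  have hterm : ∀ m, ∑' i, coeff m a * newtonCoeff z m i * newtonBasis z i x =
      coeff m a * x ^ m := fun m => by
    rw [tsum_eq_sum (s := Finset.range (m + 1)), pow_eq_sum_newtonBasis (z := z) x m,
      Finset.mul_sum]
    · exact Finset.sum_congr rfl fun i _ => by ring
    · intro i hi
      rw [newtonCoeff_eq_zero m i (by simpa using hi)]; ring
  unfold seriesEval newtonSeriesCoeff
  simp only [← hterm, ← tsum_mul_right]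
  refine (Summable.tsum_comm
    (f := fun m i => coeff m a * newtonCoeff z m i * newtonBasis z i x) ?_).symm
  refine summable_of_tendsto_zero (tendsto_cofinite_prod_of_norm_le
    (ε := fun m => B * (s / r) ^ m) ?_ (fun m i => ?_) fun m => ?_)
  · rw [Nat.cofinite_eq_atTop]
    simpa using (tendsto_pow_atTop_nhds_zero_of_lt_one (by positivity)
      ((div_lt_one hr).2 hsr)).const_mul B
  · simp only [Function.uncurry]
    calc ‖coeff m a * newtonCoeff z m i * newtonBasis z i x‖
        = ‖coeff m a‖ * (‖newtonCoeff z m i‖ * ‖newtonBasis z i x‖) := by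
          rw [norm_mul, norm_mul]; ring
      _ ≤ ‖coeff m a‖ * (‖newtonCoeff z m i‖ * s ^ i) := by
        gcongr; exact norm_newtonBasis_le hs hx i
      _ ≤ ‖coeff m a‖ * s ^ m :=
        mul_le_mul_of_nonneg_left (norm_newtonCoeff_mul_le hs0.le hs m i) (norm_nonneg _)
      _ = ‖coeff m a‖ * r ^ m * (s / r) ^ m := by rw [div_pow]; field_simp
      _ ≤ B * (s / r) ^ m := mul_le_mul_of_nonneg_right (ha m) (by positivity)
  · simp only [Function.uncurry]
    refine (summable_of_ne_finset_zero (s := Finset.range (m + 1)) fun i hi => ?_).tendsto_cofinite_zero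
    rw [newtonCoeff_eq_zero m i (by simpa using hi)]; ring

/-- Newton coefficients are controlled by the values at the nodes. -/
theorem norm_newtonSeriesCoeff_le_of_nodes {a : PowerSeries K} {r s B : ℝ} (hs0 : 0 < s)
    (hsr : s < r) (hs : ∀ j, ‖z j‖ ≤ s) (ha : GaussBound a r B) {c C D : ℝ} (hc0 : 0 < c)
    (hc : ∀ i k : ℕ, c ^ k ≤ ‖∏ j ∈ Finset.range k, (z (i + k) - z (i + j))‖)
    (hC : 1 ≤ C) (hD : 0 ≤ D) (hval : ∀ n, ‖seriesEval a (z n)‖ ≤ D * C ^ n) (n : ℕ) :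
    ‖newtonSeriesCoeff z a n‖ * c ^ n ≤ D * C ^ n := by
  induction n using Nat.strong_induction_on with
  | _ n ih =>
  have hQ : ∀ i ≤ n, ‖newtonBasis z i (z n)‖ * c ^ (n - i) ≤ ‖newtonBasis z n (z n)‖ := by
    intro i hi
    obtain ⟨k, rfl⟩ := Nat.exists_eq_add_of_le hi
    have : newtonBasis z (i + k) (z (i + k)) = newtonBasis z i (z (i + k)) *
        ∏ j ∈ Finset.range k, (z (i + k) - z (i + j)) := Finset.prod_range_add _ _ _
    rw [this, norm_mul, Nat.add_sub_cancel_left]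
    exact mul_le_mul_of_nonneg_left (hc i k) (norm_nonneg _)
  have hQn : c ^ n ≤ ‖newtonBasis z n (z n)‖ := by
    simpa [newtonBasis] using hQ 0 n.zero_le
  -- At a node the Newton expansion stops: all basis polynomials of index greater than n vanish at z
  -- n.
  have hsum : seriesEval a (z n) =
      ∑ i ∈ Finset.range n, newtonSeriesCoeff z a i * newtonBasis z i (z n) +
        newtonSeriesCoeff z a n * newtonBasis z n (z n) := by
    rw [seriesEval_eq_tsum_newtonBasis hs0 hsr hs ha (hs n), ← Finset.sum_range_succ]
    refine tsum_eq_sum fun i hi => ?_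
    rw [newtonBasis_node_eq_zero (by simpa using hi), mul_zero]
  by_contra hlt
  rw [not_le] at hlt
  -- Were the n-th coefficient too large, its term would strictly dominate all earlier ones by
  -- induction. Nothing could then cancel it, and the value at z n would exceed D C^n.
  have hG : ∀ i < n, ‖newtonSeriesCoeff z a i * newtonBasis z i (z n)‖ <
      ‖newtonSeriesCoeff z a n * newtonBasis z n (z n)‖ := by
    intro i hi
    have h1 := ih i hi
    have h2 : ‖newtonSeriesCoeff z a i‖ < ‖newtonSeriesCoeff z a n‖ * c ^ (n - i) := by
      have h3 : ‖newtonSeriesCoeff z a i‖ * c ^ i <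
          ‖newtonSeriesCoeff z a n‖ * c ^ (n - i) * c ^ i := by
        rw [mul_assoc, ← pow_add, Nat.sub_add_cancel hi.le]
        refine (h1.trans ?_).trans_lt hlt
        exact mul_le_mul_of_nonneg_left (pow_le_pow_right₀ hC hi.le) hD
      exact lt_of_mul_lt_mul_right h3 (by positivity)
    have hGn : 0 < ‖newtonSeriesCoeff z a n‖ := by
      by_contra h0
      have h0' := le_antisymm (not_lt.1 h0) (norm_nonneg _)
      rw [h0', zero_mul] at h2
      exact absurd h2 (not_lt.2 (norm_nonneg _))
    rw [norm_mul, norm_mul]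
    rcases (norm_nonneg (newtonBasis z i (z n))).eq_or_lt with h0 | h0
    · rw [← h0, mul_zero]
      exact mul_pos hGn ((pow_pos hc0 n).trans_le hQn)
    calc ‖newtonSeriesCoeff z a i‖ * ‖newtonBasis z i (z n)‖
        < ‖newtonSeriesCoeff z a n‖ * c ^ (n - i) * ‖newtonBasis z i (z n)‖ :=
          mul_lt_mul_of_pos_right h2 h0
      _ = ‖newtonSeriesCoeff z a n‖ * (‖newtonBasis z i (z n)‖ * c ^ (n - i)) := by ring
      _ ≤ _ := mul_le_mul_of_nonneg_left (hQ i hi.le) (norm_nonneg _)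
  have hlast : D * C ^ n < ‖newtonSeriesCoeff z a n * newtonBasis z n (z n)‖ := by
    rw [norm_mul]
    exact hlt.trans_le (mul_le_mul_of_nonneg_left hQn (norm_nonneg _))
  have hpos : 0 < ‖newtonSeriesCoeff z a n * newtonBasis z n (z n)‖ :=
    (by positivity : 0 ≤ D * C ^ n).trans_lt hlast
  have hS : ‖∑ i ∈ Finset.range n, newtonSeriesCoeff z a i * newtonBasis z i (z n)‖ <
      ‖newtonSeriesCoeff z a n * newtonBasis z n (z n)‖ := by
    rcases Nat.eq_zero_or_pos n with rfl | hn
    · simpa using hpos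
    · obtain ⟨i, hi, hle⟩ := IsUltrametricDist.exists_norm_finsetSum_le_of_nonempty
        (Finset.nonempty_range_iff.2 hn.ne')
        fun i => newtonSeriesCoeff z a i * newtonBasis z i (z n)
      exact hle.trans_lt (hG i (Finset.mem_range.1 hi))
  have := hval n
  rw [hsum, IsUltrametricDist.norm_add_eq_max_of_norm_ne_norm hS.ne, max_eq_right hS.le] at this
  exact absurd this (not_le.2 hlast)

/-- A three circles estimate: a power series with small values at the nodes is small. -/
theorem exists_norm_seriesEval_pow_le {r s : ℝ} (hs0 : 0 < s) (hsr : s < r) (hr1 : r < 1)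
    (hs : ∀ j, ‖z j‖ ≤ s) {c C : ℝ} (hc0 : 0 < c)
    (hc : ∀ i k : ℕ, c ^ k ≤ ‖∏ j ∈ Finset.range k, (z (i + k) - z (i + j))‖) (hC : 1 ≤ C) :
    ∃ n : ℕ, ∀ (a : PowerSeries K) (B D : ℝ), 0 ≤ D → GaussBound a r B →
      (∀ n, ‖seriesEval a (z n)‖ ≤ D * C ^ n) → ∀ x, ‖x‖ ≤ s →
      ‖seriesEval a x‖ ^ (n + 1) ≤ B ^ n * D := by
  have hr : 0 < r := hs0.trans hsr
  have hsr1 : s / r < 1 := (div_lt_one hr).2 hsr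
  -- Each term has two bounds, B(s/r)^i and D(C/c)^i. With this n, the product of n copies of the
  -- first and one of the second no longer grows with i. The choice involves neither a, B nor D.
  obtain ⟨n, hn⟩ := exists_pow_lt_of_lt_one (show 0 < c / C by positivity) hsr1
  have hn' : (s / r) ^ n * (C / c) ≤ 1 := by
    calc (s / r) ^ n * (C / c) ≤ c / C * (C / c) := by gcongr
      _ = 1 := by field_simp
  refine ⟨n, fun a B D hD ha hval x hx => ?_⟩
  have hB := ha.nonneg
  have hterm : ∀ i, ‖newtonSeriesCoeff z a i * newtonBasis z i x‖ ^ (n + 1) ≤ B ^ n * D := by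
    intro i
    have hb := norm_newtonBasis_le hs hx i
    have h1 : ‖newtonSeriesCoeff z a i * newtonBasis z i x‖ ≤ B * (s / r) ^ i := by
      rw [norm_mul]
      exact (mul_le_mul_of_nonneg_left hb (norm_nonneg _)).trans
        (norm_newtonSeriesCoeff_mul_le hs0 hsr hs ha i)
    have h2 : ‖newtonSeriesCoeff z a i * newtonBasis z i x‖ ≤ D * (C / c) ^ i := by
      rw [norm_mul]
      have h3 := norm_newtonSeriesCoeff_le_of_nodes hs0 hsr hs ha hc0 hc hC hD hval i
      rw [div_pow, mul_div_assoc', le_div_iff₀ (by positivity)]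
      have h4 : ‖newtonBasis z i x‖ ≤ 1 := hb.trans (pow_le_one₀ hs0.le (hsr.trans hr1).le)
      calc ‖newtonSeriesCoeff z a i‖ * ‖newtonBasis z i x‖ * c ^ i
          = ‖newtonSeriesCoeff z a i‖ * c ^ i * ‖newtonBasis z i x‖ := by ring
        _ ≤ ‖newtonSeriesCoeff z a i‖ * c ^ i := mul_le_of_le_one_right (by positivity) h4
        _ ≤ _ := h3
    calc ‖newtonSeriesCoeff z a i * newtonBasis z i x‖ ^ (n + 1)
        ≤ (B * (s / r) ^ i) ^ n * (D * (C / c) ^ i) := by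
          rw [pow_succ]
          exact mul_le_mul (pow_le_pow_left₀ (norm_nonneg _) h1 n) h2 (norm_nonneg _)
            (by positivity)
      _ = B ^ n * D * ((s / r) ^ n * (C / c)) ^ i := by
          rw [mul_pow B, mul_pow _ _ i, ← pow_mul, ← pow_mul, mul_comm i n]; ring
      _ ≤ B ^ n * D := mul_le_of_le_one_right (by positivity) (pow_le_one₀ (by positivity) hn')
  have hX : 0 ≤ B ^ n * D := by positivity
  -- The ultrametric bound on sums concerns norms, so the (n+1)-th root is taken before summing.
  set Y := (B ^ n * D) ^ (((n + 1 : ℕ) : ℝ)⁻¹) with hY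
  have hYn : Y ^ (n + 1) = B ^ n * D := Real.rpow_inv_natCast_pow hX n.succ_ne_zero
  have hY0 : 0 ≤ Y := Real.rpow_nonneg hX _
  rw [seriesEval_eq_tsum_newtonBasis hs0 hsr hs ha hx, ← hYn]
  refine pow_le_pow_left₀ (norm_nonneg _) (norm_tsum_le_of_le hY0 fun i => ?_) _
  refine le_of_pow_le_pow_left₀ n.succ_ne_zero hY0 ?_
  rw [hYn]
  exact hterm i

end Newton

/-! ### Generic Taylor series as Laurent series in T and as functions of u. -/

section TaylorFamilies

variable {K : Type*} [NormedField K] [IsUltrametricDist K] [CompleteSpace K]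

/-- The coefficients of a series `∑ F_m(y) (x - y)^m` of analytic elements on the unit circle, of
generic radius of convergence at least `1`. -/
def IsTaylorFamily (F : ℕ → ℤ → K) : Prop :=
  (∀ m, Tendsto (F m) cofinite (𝓝 0)) ∧
    ∀ r : ℝ, 0 ≤ r → r < 1 → ∃ C : ℝ, ∀ m k, ‖F m k‖ * r ^ m ≤ C

/-- The value at `(x, y)` of `∑ F_m(y) (x - y)^m`. -/
noncomputable def taylorValue (F : ℕ → ℤ → K) (x y : K) : K :=
  ∑' m : ℕ, laurentEval (F m) y * (x - y) ^ m

/-- The coefficients of the Laurent series `∑ F_m(T) (z T)^m`. -/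
noncomputable def taylorCoeff (F : ℕ → ℤ → K) (z : K) (k : ℤ) : K :=
  ∑' m : ℕ, F m (k - m) * z ^ m

variable {F : ℕ → ℤ → K}

theorem IsTaylorFamily.discConvergent (hF : IsTaylorFamily F) (k : ℤ) :
    DiscConvergent (PowerSeries.mk fun m => F m (k - m)) := fun r h0 h1 => by
  obtain ⟨C, hC⟩ := hF.2 r h0 h1
  exact ⟨C, fun m => by simpa using hC m (k - m)⟩

theorem taylorCoeff_eq_seriesEval (z : K) (k : ℤ) :
    taylorCoeff F z k = seriesEval (PowerSeries.mk fun m => F m (k - m)) z := by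
  simp [taylorCoeff, seriesEval]

theorem IsTaylorFamily.summable (hF : IsTaylorFamily F) {z : K} (hz : ‖z‖ < 1) (k : ℤ) :
    Summable fun m : ℕ => F m (k - m) * z ^ m := by
  obtain ⟨r, s, h1, _, h⟩ := (hF.discConvergent k).exists_bound hz
  simpa using (h.summable_norm h1).of_norm

/-- Terms decay like (|z|/r)^m uniformly in k, and tend to zero in k for each m; this justifies
reordering by powers of T. -/
theorem IsTaylorFamily.summable_prod (hF : IsTaylorFamily F) {z x : K} (hz : ‖z‖ < 1)
    (hx : ‖x‖ = 1) : Summable fun w : ℕ × ℤ => F w.1 (w.2 - w.1) * z ^ w.1 * x ^ w.2 := by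
  refine summable_of_tendsto_zero ?_
  obtain ⟨r, h1, h2⟩ := exists_between hz
  have h0 : 0 < r := (norm_nonneg _).trans_lt h1
  obtain ⟨C, hC⟩ := hF.2 r h0.le h2
  refine tendsto_cofinite_prod_of_norm_le (ε := fun m : ℕ => C * (‖z‖ / r) ^ m) ?_
    (fun m k => ?_) fun m => ?_
  · rw [Nat.cofinite_eq_atTop]
    simpa using (tendsto_pow_atTop_nhds_zero_of_lt_one (by positivity)
      ((div_lt_one h0).2 h1)).const_mul C
  · rw [norm_mul, norm_mul, norm_pow, norm_zpow, hx, one_zpow, mul_one, div_pow, mul_div_assoc',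
      le_div_iff₀ (by positivity)]
    calc ‖F m (k - m)‖ * ‖z‖ ^ m * r ^ m = ‖F m (k - m)‖ * r ^ m * ‖z‖ ^ m := by ring
      _ ≤ _ := mul_le_mul_of_nonneg_right (hC m _) (by positivity)
  · have h3 : Tendsto (fun k : ℤ => F m (k - m)) cofinite (𝓝 0) :=
      (hF.1 m).comp (Equiv.subRight (m : ℤ)).injective.tendsto_cofinite
    have h4 := tendsto_mul_zpow h3 hx
    have h5 := h4.const_mul (z ^ m)
    rw [mul_zero] at h5
    exact h5.congr fun k => by ring

theorem IsTaylorFamily.tendsto_taylorCoeff (hF : IsTaylorFamily F) {z : K} (hz : ‖z‖ < 1) :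
    Tendsto (taylorCoeff F z) cofinite (𝓝 0) := by
  have h := ((Equiv.prodComm ℤ ℕ).summable_iff.2
    (hF.summable_prod hz (norm_one (α := K)))).prod.tendsto_cofinite_zero
  refine h.congr fun k => ?_
  simp [taylorCoeff]

theorem IsTaylorFamily.laurentEval_taylorCoeff (hF : IsTaylorFamily F) {z x : K} (hz : ‖z‖ < 1)
    (hx : ‖x‖ = 1) :
    laurentEval (taylorCoeff F z) x = ∑' m : ℕ, laurentEval (F m) x * (z * x) ^ m := by
  have hx0 : x ≠ 0 := norm_ne_zero_iff.1 (by rw [hx]; exact one_ne_zero)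
  unfold laurentEval taylorCoeff
  simp only [← tsum_mul_right]
  rw [Summable.tsum_comm (f := fun (m : ℕ) (k : ℤ) => F m (k - m) * z ^ m * x ^ k)
    (hF.summable_prod hz hx)]
  refine tsum_congr fun m => ?_
  rw [← (Equiv.subRight (m : ℤ)).tsum_eq fun k => F m k * x ^ k * (z * x) ^ m]
  refine tsum_congr fun k => ?_
  rw [Equiv.subRight_apply, zpow_sub₀ hx0, zpow_natCast, mul_pow]
  field_simp

theorem IsTaylorFamily.laurentEval_taylorCoeff_sub_one (hF : IsTaylorFamily F) (u : unitDisk K)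
    {x : K} (hx : ‖x‖ = 1) :
    laurentEval (taylorCoeff F (((u : Kˣ) : K) - 1)) x =
      taylorValue F (((u : Kˣ) : K) * x) x := by
  rw [hF.laurentEval_taylorCoeff (norm_sub_one_lt u) hx, taylorValue]
  exact tsum_congr fun m => by rw [sub_mul, one_mul]

theorem IsTaylorFamily.bound_laurentEval (hF : IsTaylorFamily F) {y : K} (hy : ‖y‖ = 1) (r : ℝ)
    (h0 : 0 ≤ r) (h1 : r < 1) : ∃ C, ∀ m, ‖laurentEval (F m) y‖ * r ^ m ≤ C := by
  obtain ⟨C, hC⟩ := hF.2 r h0 h1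
  refine ⟨C, fun m => ?_⟩
  have hC0 : 0 ≤ C := (by positivity : 0 ≤ ‖F 0 0‖ * r ^ 0).trans (hC 0 0)
  rcases (pow_nonneg h0 m).eq_or_lt with h | h
  · rw [← h]; simpa using hC0
  rw [← le_div_iff₀ h]
  refine norm_tsum_le_of_le (div_nonneg hC0 h.le) fun k => ?_
  rw [norm_mul, norm_zpow, hy, one_zpow, mul_one, le_div_iff₀ h]
  exact hC m k

/-- The increment is ux - y = x(u-1) + (x-y), a polynomial in u-1 that sends the disc of radius r
into that of radius max(r, |x-y|) < 1. -/
theorem IsTaylorFamily.isDiscAnalytic (hF : IsTaylorFamily F) {x y : K} (hx : ‖x‖ = 1)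
    (hy : ‖y‖ = 1) (hxy : ‖x - y‖ < 1) :
    IsDiscAnalytic fun u : unitDisk K => taylorValue F (((u : Kˣ) : K) * x) y := by
  have hb : ∀ r : ℝ, 0 ≤ r → GaussBound (PowerSeries.C x * PowerSeries.X + PowerSeries.C (x - y))
      r (max r ‖x - y‖) := fun r h0 => by
    refine GaussBound.add h0 ?_ ((GaussBound.C _ r).mono (le_max_right _ _))
    have := (GaussBound.C x r).mul h0 (GaussBound.X h0)
    rw [hx, one_mul] at this
    exact this.mono (le_max_left _ _)
  have key := isDiscAnalytic_comp (hF.bound_laurentEval hy)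
    fun r h0 h1 => ⟨_, max_lt h1 hxy, hb r h0⟩
  refine (congrArg IsDiscAnalytic (funext fun u => ?_)).mpr key
  refine tsum_congr fun m => ?_
  obtain ⟨r, h1, h2⟩ := exists_between (norm_sub_one_lt u)
  have h0 := (norm_nonneg _).trans h1.le
  rw [seriesEval_add ((GaussBound.C x r).mul h0 (GaussBound.X h0)) (GaussBound.C _ r) h1,
    seriesEval_mul (GaussBound.C x r) (GaussBound.X h0) h1, seriesEval_C, seriesEval_C,
    seriesEval_X]
  congr 2
  ring

/-- The recursion (1+z)^{n+1} - 1 = (1+z)((1+z)^n - 1) + z shows that u ↦ u^n preserves every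
smaller disc around 1. This allows substituting v^{p^h} in the Frobenius argument. -/
theorem exists_pow_sub_one_series (n : ℕ) : ∃ g : PowerSeries K,
    (∀ r : ℝ, 0 ≤ r → r < 1 → GaussBound g r r) ∧
      ∀ z : K, ‖z‖ < 1 → seriesEval g z = (1 + z) ^ n - 1 := by
  induction n with
  | zero =>
    refine ⟨PowerSeries.C 0, fun r h0 h1 => ?_, fun z _ => by rw [seriesEval_C]; simp⟩
    exact (GaussBound.C (0 : K) r).mono (by simpa using h0)
  | succ n ih =>
    obtain ⟨g, hg, he⟩ := ih
    have h1X : ∀ r : ℝ, 0 ≤ r → r < 1 → GaussBound (1 + PowerSeries.X : PowerSeries K) r 1 :=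
      fun r h0 h1 => (GaussBound.one r).add h0 ((GaussBound.X h0).mono h1.le)
    refine ⟨(1 + PowerSeries.X) * g + PowerSeries.X, fun r h0 h1 => ?_, fun z hz => ?_⟩
    · have := (h1X r h0 h1).mul h0 (hg r h0 h1)
      rw [one_mul] at this
      exact this.add h0 (GaussBound.X h0)
    · obtain ⟨r, h1, h2⟩ := exists_between hz
      have h0 := (norm_nonneg _).trans h1.le
      rw [seriesEval_add ((h1X r h0 h2).mul h0 (hg r h0 h2)) (GaussBound.X h0) h1,
        seriesEval_mul (h1X r h0 h2) (hg r h0 h2) h1,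
        seriesEval_add (GaussBound.one r) (GaussBound.X h0) h1, seriesEval_one, seriesEval_X,
        he z hz]
      ring

theorem IsTaylorFamily.isDiscAnalytic_pow (hF : IsTaylorFamily F) {x : K} (hx : ‖x‖ = 1) (n : ℕ) :
    IsDiscAnalytic fun u : unitDisk K =>
      taylorValue F ((((u : Kˣ) : K) * x) ^ n) (x ^ n) := by
  obtain ⟨g, hg, he⟩ := exists_pow_sub_one_series (K := K) n
  have hxn : ‖x ^ n‖ = 1 := by rw [norm_pow, hx, one_pow]
  have hb : ∀ r : ℝ, 0 ≤ r → r < 1 → GaussBound (PowerSeries.C (x ^ n) * g) r r :=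
    fun r h0 h1 => by
      have := (GaussBound.C (x ^ n) r).mul h0 (hg r h0 h1)
      rwa [hxn, one_mul] at this
  have key := isDiscAnalytic_comp (hF.bound_laurentEval hxn)
    fun r h0 h1 => ⟨r, h1, hb r h0 h1⟩
  refine (congrArg IsDiscAnalytic (funext fun u => ?_)).mpr key
  refine tsum_congr fun m => ?_
  obtain ⟨r, h1, h2⟩ := exists_between (norm_sub_one_lt u)
  rw [seriesEval_mul (GaussBound.C _ r) (hg r ((norm_nonneg _).trans h1.le) h2) h1, seriesEval_C,
    he _ (norm_sub_one_lt u), add_sub_cancel, mul_pow]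
  congr 2
  ring

theorem IsTaylorFamily.map (hF : IsTaylorFamily F) (ψ : K →+* K) (hψ : ∀ x, ‖ψ x‖ ≤ ‖x‖) :
    IsTaylorFamily fun m k => ψ (F m k) := by
  refine ⟨fun m => ?_, fun r h0 h1 => ?_⟩
  · exact squeeze_zero_norm (fun k => hψ _) (tendsto_zero_iff_norm_tendsto_zero.1 (hF.1 m))
  · obtain ⟨C, hC⟩ := hF.2 r h0 h1
    exact ⟨C, fun m k => (mul_le_mul_of_nonneg_right (hψ _) (by positivity)).trans (hC m k)⟩

theorem IsTaylorFamily.map_taylorCoeff (hF : IsTaylorFamily F) (ψ : K →+* K)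
    (hψ : ∀ x, ‖ψ x‖ ≤ ‖x‖) {z : K} (hz : ‖z‖ < 1) (k : ℤ) :
    ψ (taylorCoeff F z k) = taylorCoeff (fun m k => ψ (F m k)) (ψ z) k := by
  have hcont : Continuous ψ :=
    AddMonoidHomClass.continuous_of_bound ψ 1 fun x => by simpa using hψ x
  unfold taylorCoeff
  rw [(hF.summable hz k).map_tsum ψ hcont]
  exact tsum_congr fun m => by simp

/-- If the Laurent series `∑ F_m(T) ((q^n - 1) T)^m` are overconvergent for all `n ≥ 0`, with
bounds growing geometrically on some annulus, then so is `∑ F_m(T) ((u - 1) T)^m`. -/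
theorem IsTaylorFamily.isOverconvergent_taylorCoeff [CharZero K] {p : ℕ} [Fact p.Prime]
    (hp : ‖(p : K)‖ < 1) (hF : IsTaylorFamily F) {q : K} (hq : ‖q - 1‖ < 1)
    (hq1 : ∀ m, 0 < m → q ^ m ≠ 1) {ρ C : ℝ} (hρ : 1 < ρ) (hC : 1 ≤ C)
    (h : ∀ (n : ℕ) (k : ℤ), ‖taylorCoeff F (q ^ n - 1) k‖ ≤ C ^ n * (ρ ^ k.natAbs)⁻¹)
    {z : K} (hz : ‖z‖ < 1) : IsOverconvergent (taylorCoeff F z) := by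
  have hq0 : 0 < ‖q - 1‖ := norm_pos_iff.2 (sub_ne_zero.2 (by simpa using hq1 1 one_pos))
  obtain ⟨r, hr, hr1⟩ := exists_between (max_lt hz hq)
  have hs0 : 0 < max ‖z‖ ‖q - 1‖ := lt_max_of_lt_right hq0
  obtain ⟨c, hc0, hc⟩ := exists_pow_le_norm_prod_pow_sub hp hq hq1
  have hqn : ‖q‖ = 1 := by
    have h2 := IsUltrametricDist.norm_add_eq_max_of_norm_ne_norm
      (x := q - 1) (y := 1) (by rw [norm_one]; exact hq.ne)
    rwa [sub_add_cancel, norm_one, max_eq_right hq.le] at h2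
  have hnodes : ∀ j : ℕ, ‖q ^ j - 1‖ ≤ max ‖z‖ ‖q - 1‖ := fun j => by
    rw [← geom_sum_mul, norm_mul]
    refine (mul_le_of_le_one_left (norm_nonneg _) ?_).trans (le_max_right _ _)
    refine IsUltrametricDist.norm_sum_le_of_forall_le_of_nonneg zero_le_one fun i _ => ?_
    rw [norm_pow, hqn, one_pow]
  -- The radius max(|z|, |q-1|) covers both z and all nodes q^j - 1. The exponent n is obtained
  -- before k is fixed, so one radius ρ^{1/(n+1)} serves all coefficients.
  obtain ⟨n, hn⟩ := exists_norm_seriesEval_pow_le hs0 hr hr1 hnodes hc0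
    (by simpa only [sub_sub_sub_cancel_right] using hc) hC
  obtain ⟨B, hB⟩ := hF.2 r (hs0.trans hr).le hr1
  have hρ0 : 0 < ρ := zero_lt_one.trans hρ
  set s : ℝ := ρ ^ (((n + 1 : ℕ) : ℝ)⁻¹) with hs
  have hs1 : 1 < s := Real.one_lt_rpow hρ (inv_pos.2 (by positivity))
  have hsn : s ^ (n + 1) = ρ := Real.rpow_inv_natCast_pow hρ0.le n.succ_ne_zero
  have hs00 : 0 < s := zero_lt_one.trans hs1
  have hB0 : 0 ≤ B := (by have := hs0.trans hr; positivity : 0 ≤ ‖F 0 0‖ * r ^ 0).trans (hB 0 0)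
  have hX1 : 1 ≤ max B 1 := le_max_right _ _
  refine ⟨s, hs1, max B 1, fun k => ?_⟩
  have hk := hn (PowerSeries.mk fun m => F m (k - m)) B (ρ ^ k.natAbs)⁻¹ (by positivity)
    (fun m => by simpa using hB m (k - m))
    (fun j => by rw [← taylorCoeff_eq_seriesEval, mul_comm]; exact h j k) z (le_max_left _ _)
  rw [← taylorCoeff_eq_seriesEval] at hk
  refine le_of_pow_le_pow_left₀ n.succ_ne_zero (by positivity) (hk.trans ?_)
  rw [mul_pow, inv_pow, ← pow_mul, mul_comm k.natAbs, pow_mul, hsn]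
  refine mul_le_mul_of_nonneg_right ?_ (by positivity)
  calc B ^ n ≤ (max B 1) ^ n := pow_le_pow_left₀ hB0 (le_max_left _ _) n
    _ ≤ (max B 1) ^ (n + 1) := pow_le_pow_right₀ hX1 n.le_succ

end TaylorFamilies

/-! ### Coefficient bounds on a fixed annulus. -/

section Bounds

variable {K : Type*} [NormedField K] [IsUltrametricDist K] [CompleteSpace K]

/-- From |k| ≤ |i| + |k-i| and the ultrametric inequality the radius ρ is kept exactly, with
constants multiplying; iterated products therefore grow only geometrically. -/
theorem norm_coeff_mul_le {f g : HDagger K} {ρ A B : ℝ} (hρ : 1 ≤ ρ)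
    (hf : ∀ k, ‖f.coeff k‖ ≤ A * (ρ ^ k.natAbs)⁻¹) (hg : ∀ k, ‖g.coeff k‖ ≤ B * (ρ ^ k.natAbs)⁻¹)
    (k : ℤ) : ‖(f * g).coeff k‖ ≤ A * B * (ρ ^ k.natAbs)⁻¹ := by
  have hρ0 : 0 < ρ := zero_lt_one.trans_le hρ
  have hA : 0 ≤ A := by simpa using (norm_nonneg _).trans (hf 0)
  have hB : 0 ≤ B := by simpa using (norm_nonneg _).trans (hg 0)
  rw [HDagger.coeff_mul]
  refine norm_tsum_le_of_le (by positivity) fun i => ?_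
  rw [norm_mul]
  refine (mul_le_mul (hf i) (hg _) (norm_nonneg _) (by positivity)).trans ?_
  calc A * (ρ ^ i.natAbs)⁻¹ * (B * (ρ ^ (k - i).natAbs)⁻¹)
      = A * B * (ρ ^ (i.natAbs + (k - i).natAbs))⁻¹ := by rw [pow_add, mul_inv]; ring
    _ ≤ _ := by
      refine mul_le_mul_of_nonneg_left ?_ (by positivity)
      exact inv_anti₀ (by positivity) (pow_le_pow_right₀ hρ (by omega))

theorem HDagger.coeff_sum {ι : Type*} (s : Finset ι) (f : ι → HDagger K) (k : ℤ) :
    (∑ i ∈ s, f i).coeff k = ∑ i ∈ s, (f i).coeff k := by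
  classical
  induction s using Finset.induction_on with
  | empty => simp [HDagger.coeff_zero]
  | insert a s ha ih => rw [Finset.sum_insert ha, Finset.sum_insert ha, HDagger.coeff_add, ih]

theorem exists_common_overconvergence {ι : Type*} (s : Finset ι) (f : ι → HDagger K) :
    ∃ ρ : ℝ, 1 < ρ ∧ ∃ C : ℝ, 1 ≤ C ∧ ∀ i ∈ s, ∀ k, ‖(f i).coeff k‖ ≤ C * (ρ ^ k.natAbs)⁻¹ := by
  classical
  induction s using Finset.induction_on with
  | empty => exact ⟨2, one_lt_two, 1, le_rfl, by simp⟩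
  | insert a s ha ih =>
    obtain ⟨ρ, hρ, C, hC, h⟩ := ih
    obtain ⟨ρ', hρ', C', h'⟩ := (f a).overconvergent
    have hm : 1 < min ρ ρ' := lt_min hρ hρ'
    have hp : ∀ k : ℤ, 0 ≤ ((min ρ ρ') ^ k.natAbs)⁻¹ := fun k =>
      inv_nonneg.2 (pow_nonneg (by linarith) _)
    refine ⟨min ρ ρ', hm, max C C', hC.trans (le_max_left _ _), fun i hi k => ?_⟩
    rcases Finset.mem_insert.1 hi with rfl | hi
    · exact (HDagger.isOverconvergent_mono h' hm (min_le_right _ _) k).trans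
        (mul_le_mul_of_nonneg_right (le_max_right _ _) (hp k))
    · exact (HDagger.isOverconvergent_mono (h i hi) hm (min_le_left _ _) k).trans
        (mul_le_mul_of_nonneg_right (le_max_left _ _) (hp k))

end Bounds

/-! ### Matrices, cocycles and Taylor solutions of σ-modules. -/

section Sigma

variable {K : Type*} [NormedField K] [IsUltrametricDist K] [CompleteSpace K]

theorem coeff_sigmaHom (u : unitDisk K) (f : HDagger K) (k : ℤ) :
    (sigmaHom u f).coeff k = ((u : Kˣ) : K) ^ k * f.coeff k := rfl

theorem sigmaHom_one (f : HDagger K) : sigmaHom (1 : unitDisk K) f = f := by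
  ext k
  simp [coeff_sigmaHom]

theorem sigmaHom_mul (u v : unitDisk K) (f : HDagger K) :
    sigmaHom (u * v) f = sigmaHom u (sigmaHom v f) := by
  ext k
  simp only [coeff_sigmaHom, Subgroup.coe_mul, Units.val_mul, mul_zpow]
  ring

theorem norm_mul_sub_lt (u : unitDisk K) {x y : K} (hx : ‖x‖ = 1) (hxy : ‖x - y‖ < 1) :
    ‖((u : Kˣ) : K) * x - y‖ < 1 := by
  have h : ((u : Kˣ) : K) * x - y = (((u : Kˣ) : K) - 1) * x + (x - y) := by ring
  rw [h]
  refine (IsUltrametricDist.norm_add_le_max _ _).trans_lt (max_lt ?_ hxy)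
  rw [norm_mul, hx, mul_one]
  exact norm_sub_one_lt u

variable {M : Type*} [AddCommGroup M] [Module (HDagger K) M] {d : ℕ}

/-- Two semilinear maps that agree on a basis are equal. -/
theorem semilinear_eq_of_basis {R N : Type*} [CommRing R] [AddCommGroup N] [Module R N]
    (b : Module.Basis (Fin d) R N) (τ : R → R) {f g : N →+ N}
    (hf : ∀ (c : R) (m : N), f (c • m) = τ c • f m)
    (hg : ∀ (c : R) (m : N), g (c • m) = τ c • g m) (h : ∀ i, f (b i) = g (b i)) : f = g := by
  ext m
  rw [← b.sum_repr m, map_sum, map_sum]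
  exact Finset.sum_congr rfl fun i _ => by rw [hf, hg, h]

namespace SigmaStructure

variable {G : Subgroup (unitDisk K)}

theorem act_basis (E : SigmaStructure G M) (b : Module.Basis (Fin d) (HDagger K) M) (g : G)
    (i : Fin d) : E.act g (b i) = ∑ j, E.matrix b g i j • b j :=
  (b.sum_repr _).symm

theorem matrix_mul (E : SigmaStructure G M) (b : Module.Basis (Fin d) (HDagger K) M) (g h : G) :
    E.matrix b (g * h) = (E.matrix b h).map (sigmaHom (g : unitDisk K)) * E.matrix b g := by
  ext1 i j
  have h1 : E.act (g * h) (b i) = E.act g (E.act h (b i)) := by rw [map_mul]; rfl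
  rw [Matrix.mul_apply]
  conv_lhs => rw [SigmaStructure.matrix, h1, E.act_basis b h i, map_sum, map_sum]
  simp only [E.act_smul, Finsupp.coe_finsetSum, Finset.sum_apply, map_smul, Finsupp.smul_apply,
    smul_eq_mul, Matrix.map_apply]
  rfl

theorem matrix_one (E : SigmaStructure G M) (b : Module.Basis (Fin d) (HDagger K) M) :
    E.matrix b 1 = 1 := by
  ext1 i j
  have h1 : E.act 1 (b i) = b i := by rw [map_one]; rfl
  rw [SigmaStructure.matrix, h1, b.repr_self, Finsupp.single_apply, Matrix.one_apply]

/-- The semilinear map with a given matrix. -/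
noncomputable def semilinearOfMatrix (b : Module.Basis (Fin d) (HDagger K) M)
    (A : Matrix (Fin d) (Fin d) (HDagger K)) (u : unitDisk K) : M →+ M where
  toFun m := ∑ i, sigmaHom u (b.repr m i) • ∑ j, A i j • b j
  map_zero' := by simp
  map_add' m n := by simp [add_smul, Finset.sum_add_distrib]

theorem semilinearOfMatrix_smul (b : Module.Basis (Fin d) (HDagger K) M)
    (A : Matrix (Fin d) (Fin d) (HDagger K)) (u : unitDisk K) (f : HDagger K) (m : M) :
    semilinearOfMatrix b A u (f • m) = sigmaHom u f • semilinearOfMatrix b A u m := by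
  change ∑ i, sigmaHom u (b.repr (f • m) i) • ∑ j, A i j • b j =
    sigmaHom u f • ∑ i, sigmaHom u (b.repr m i) • ∑ j, A i j • b j
  rw [Finset.smul_sum]
  exact Finset.sum_congr rfl fun i _ => by
    rw [map_smul, Finsupp.smul_apply, smul_eq_mul, map_mul, mul_smul]

theorem semilinearOfMatrix_basis (b : Module.Basis (Fin d) (HDagger K) M)
    (A : Matrix (Fin d) (Fin d) (HDagger K)) (u : unitDisk K) (i : Fin d) :
    semilinearOfMatrix b A u (b i) = ∑ j, A i j • b j := by
  change ∑ l, sigmaHom u (b.repr (b i) l) • ∑ j, A l j • b j = _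
  rw [Finset.sum_eq_single i]
  · simp
  · intro l _ hl
    rw [b.repr_self, Finsupp.single_eq_of_ne hl, map_zero, zero_smul]
  · simp

/-- The `σ`-module over the whole disc given by a cocycle of matrices. -/
noncomputable def ofMatrix (b : Module.Basis (Fin d) (HDagger K) M)
    (A : unitDisk K → Matrix (Fin d) (Fin d) (HDagger K)) (h1 : A 1 = 1)
    (hmul : ∀ u v, A (u * v) = (A v).map (sigmaHom u) * A u) :
    SigmaStructure (⊤ : Subgroup (unitDisk K)) M where
  act :=
    { toFun := fun g => semilinearOfMatrix b (A g) g
      map_one' := by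
        refine semilinear_eq_of_basis b id (fun c m => ?_) (fun c m => rfl) fun i => ?_
        · rw [semilinearOfMatrix_smul, OneMemClass.coe_one, sigmaHom_one]; rfl
        · rw [semilinearOfMatrix_basis, OneMemClass.coe_one, h1]
          simp [Matrix.one_apply]
          rfl
      map_mul' := fun g h => by
        refine semilinear_eq_of_basis b (sigmaHom ((g * h : (⊤ : Subgroup (unitDisk K))) :
          unitDisk K)) (fun c m => semilinearOfMatrix_smul _ _ _ _ _) (fun c m => ?_) fun i => ?_
        · change semilinearOfMatrix b (A g) g (semilinearOfMatrix b (A h) h (c • m)) =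
            _ • semilinearOfMatrix b (A g) g (semilinearOfMatrix b (A h) h m)
          rw [semilinearOfMatrix_smul, semilinearOfMatrix_smul, Subgroup.coe_mul, sigmaHom_mul]
        · change _ = semilinearOfMatrix b (A g) g (semilinearOfMatrix b (A h) h (b i))
          rw [semilinearOfMatrix_basis, semilinearOfMatrix_basis, Subgroup.coe_mul, hmul, map_sum]
          simp only [semilinearOfMatrix_smul, semilinearOfMatrix_basis, Matrix.mul_apply,
            Matrix.map_apply, Finset.sum_smul, Finset.smul_sum, mul_smul]
          exact Finset.sum_comm }
  act_smul g f m := semilinearOfMatrix_smul _ _ _ _ _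

theorem ofMatrix_matrix (b : Module.Basis (Fin d) (HDagger K) M)
    (A : unitDisk K → Matrix (Fin d) (Fin d) (HDagger K)) (h1 : A 1 = 1)
    (hmul : ∀ u v, A (u * v) = (A v).map (sigmaHom u) * A u) (g : (⊤ : Subgroup (unitDisk K))) :
    (ofMatrix b A h1 hmul).matrix b g = A g := by
  ext1 i j
  change b.repr (semilinearOfMatrix b (A g) g (b i)) j = _
  rw [semilinearOfMatrix_basis]
  simp [Finsupp.single_apply]

theorem eq_of_act_eq {E E' : SigmaStructure G M} (h : ∀ g m, E.act g m = E'.act g m) : E = E' :=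
  SigmaStructure.ext (MonoidHom.ext fun g => AddMonoidHom.ext (h g))

theorem eq_of_matrix_eq {E E' : SigmaStructure G M} (b : Module.Basis (Fin d) (HDagger K) M)
    (h : ∀ g, E.matrix b g = E'.matrix b g) : E = E' := by
  refine eq_of_act_eq fun g m => DFunLike.congr_fun (semilinear_eq_of_basis b (sigmaHom (g : unitDisk K))
    (f := E.act g) (g := E'.act g) (E.act_smul g) (E'.act_smul g) fun i => ?_) m
  exact (E.act_basis b g i).trans (by rw [h]; exact (E'.act_basis b g i).symm)

/-- A solution `Y(x, y) = ∑ F_m(y) (x - y)^m` of the equations of a `σ`-module. -/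
structure IsTaylorSolution (E : SigmaStructure G M) (b : Module.Basis (Fin d) (HDagger K) M)
    (F : ℕ → Matrix (Fin d) (Fin d) (ℤ → K)) : Prop where
  family : ∀ i j, IsTaylorFamily fun m => F m i j
  diag : ∀ y : K, ‖y‖ = 1 → taylorEval F y y = 1
  equation : ∀ (g : G) (x y : K), ‖x‖ = 1 → ‖y‖ = 1 → ‖x - y‖ < 1 →
      taylorEval F (((g : unitDisk K) : Kˣ) * x) y =
        (E.matrix b g).map (fun f => laurentEval f.coeff x) * taylorEval F x y

theorem IsSolvable.exists_solution {E : SigmaStructure G M} (h : E.IsSolvable) :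
    ∃ (d : ℕ) (b : Module.Basis (Fin d) (HDagger K) M)
      (F : ℕ → Matrix (Fin d) (Fin d) (ℤ → K)), E.IsTaylorSolution b F := by
  obtain ⟨d, b, F, h1, h2, h3, h4⟩ := h
  refine ⟨d, b, F, fun i j => ⟨fun m => h1 m i j, fun r h0 hr => ?_⟩, h3, h4⟩
  obtain ⟨C, hC⟩ := h2 r h0 hr
  exact ⟨C, fun m k => hC m i j k⟩

theorem IsTaylorSolution.isSolvable {E : SigmaStructure G M}
    {b : Module.Basis (Fin d) (HDagger K) M} {F : ℕ → Matrix (Fin d) (Fin d) (ℤ → K)}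
    (h : E.IsTaylorSolution b F) : E.IsSolvable := by
  refine ⟨d, b, F, fun m i j => (h.family i j).1 m, fun r h0 h1 => ?_, h.diag, h.equation⟩
  choose C hC using fun i j => (h.family i j).2 r h0 h1
  obtain ⟨B, hB⟩ := (Set.finite_range fun w : Fin d × Fin d => C w.1 w.2).bddAbove
  exact ⟨B, fun m i j k => (hC i j m k).trans (hB ⟨(i, j), rfl⟩)⟩

section Solution

variable {E : SigmaStructure G M} {b : Module.Basis (Fin d) (HDagger K) M}
  {F : ℕ → Matrix (Fin d) (Fin d) (ℤ → K)}

/-- The equation at y = x, together with Y(x,x) = 1, shows that Y determines the matrix of every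
operator. -/
theorem IsTaylorSolution.eval_matrix (h : E.IsTaylorSolution b F) (g : G) {x : K} (hx : ‖x‖ = 1) :
    (E.matrix b g).map (fun f => laurentEval f.coeff x) =
      taylorEval F (((g : unitDisk K) : Kˣ) * x) x := by
  rw [h.equation g x x hx hx (by simp), h.diag x hx, mul_one]

/-- Values on the circle determine Laurent coefficients; the element c only witnesses that the
absolute value is nontrivial. -/
theorem IsTaylorSolution.coeff_matrix (h : E.IsTaylorSolution b F) {c : K} (hc0 : c ≠ 0)
    (hc : ‖c‖ < 1) (g : G) (i j : Fin d) :
    (E.matrix b g i j).coeff =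
      taylorCoeff (fun m => F m i j) ((((g : unitDisk K) : Kˣ) : K) - 1) := by
  refine eq_of_laurentEval_eq hc0 hc (HDagger.tendsto_coeff _)
    ((h.family i j).tendsto_taylorCoeff (norm_sub_one_lt _)) fun x hx => ?_
  rw [(h.family i j).laurentEval_taylorCoeff_sub_one _ hx]
  exact congrFun (congrFun (h.eval_matrix g hx) i) j

end Solution

end SigmaStructure

end Sigma

/-! ### Extension of the action to the whole disc. -/

section Existence

variable {p : ℕ} [Fact p.Prime] {K : Type*} [NormedField K] [IsUltrametricDist K]
  [CompleteSpace K] [CharZero K] {M : Type*} [AddCommGroup M] [Module (HDagger K) M] {d : ℕ}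
  {q : unitDisk K}

namespace SigmaStructure

/-- By the cocycle rule A(g^n) is a product of n translates of A(g), and each σ_u preserves
coefficient norms because |u| = 1. -/
theorem exists_norm_coeff_matrix_pow_le {G : Subgroup (unitDisk K)} (E : SigmaStructure G M)
    (b : Module.Basis (Fin d) (HDagger K) M) (g : G) :
    ∃ ρ : ℝ, 1 < ρ ∧ ∃ C : ℝ, 1 ≤ C ∧ ∀ n i j k,
      ‖(E.matrix b (g ^ n) i j).coeff k‖ ≤ C ^ n * (ρ ^ k.natAbs)⁻¹ := by
  obtain ⟨ρ, hρ, C, hC, h⟩ := exists_common_overconvergence Finset.univ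
    fun w : Fin d × Fin d => E.matrix b g w.1 w.2
  have hρ0 : 0 < ρ := zero_lt_one.trans hρ
  refine ⟨ρ, hρ, C, hC, fun n => ?_⟩
  induction n with
  | zero =>
    intro i j k
    rw [pow_zero, pow_zero, E.matrix_one, one_mul, Matrix.one_apply]
    split_ifs with hij
    · rw [HDagger.coeff_one]
      rcases eq_or_ne k 0 with rfl | hk
      · simp
      · rw [Pi.single_eq_of_ne hk, norm_zero]; positivity
    · rw [HDagger.coeff_zero, norm_zero]; positivity
  | succ n ih =>
    intro i j k
    rw [pow_succ', E.matrix_mul, Matrix.mul_apply, HDagger.coeff_sum]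
    refine IsUltrametricDist.norm_sum_le_of_forall_le_of_nonneg (by positivity) fun l _ => ?_
    rw [pow_succ]
    refine norm_coeff_mul_le hρ.le (fun k => ?_) (h (l, j) (Finset.mem_univ _)) k
    rw [Matrix.map_apply, coeff_sigmaHom, norm_mul, norm_zpow, norm_eq_one_of_mem_unitDisk,
      one_zpow, one_mul]
    exact ih i l k

theorem coe_pow_unitDisk (u : unitDisk K) (n : ℕ) :
    (((u ^ n : unitDisk K) : Kˣ) : K) = ((u : Kˣ) : K) ^ n := by simp

theorem pow_ne_one_of_unitDisk (hq : ∀ m : ℕ, 0 < m → q ^ m ≠ 1) (m : ℕ) (hm : 0 < m) :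
    ((q : Kˣ) : K) ^ m ≠ 1 := by
  intro h
  refine hq m hm (Subtype.ext (Units.ext ?_))
  rw [coe_pow_unitDisk, h]; simp

/-- Analytic functions on the disc that agree at the powers `q ^ p ^ n` are equal. -/
theorem eq_of_eq_on_powers (hp : ‖(p : K)‖ < 1) (hq : ∀ m : ℕ, 0 < m → q ^ m ≠ 1)
    {f g : unitDisk K → K} (hf : IsDiscAnalytic f) (hg : IsDiscAnalytic g)
    (h : ∀ n : ℕ, f (q ^ n) = g (q ^ n)) : f = g := by
  refine hf.eq_of_eq_on_seq hg (w := fun n => q ^ p ^ n) ?_ (fun n => ?_) fun n => h _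
  · simp only [coe_pow_unitDisk]
    exact tendsto_pow_prime_pow hp (norm_sub_one_lt q)
  · exact hq _ (pow_pos (Fact.out : p.Prime).pos n)

theorem exists_isTaylorExtension (hp : ‖(p : K)‖ < 1) (hq : ∀ m : ℕ, 0 < m → q ^ m ≠ 1)
    (σ : SigmaStructure (Subgroup.zpowers q) M) (hσ : σ.IsSolvable) :
    ∃ E : SigmaStructure (⊤ : Subgroup (unitDisk K)) M, σ.IsTaylorExtension E := by
  have hp0 : (p : K) ≠ 0 := Nat.cast_ne_zero.2 (Fact.out : p.Prime).ne_zero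
  obtain ⟨d, b, F, hF⟩ := hσ.exists_solution
  let γ : Subgroup.zpowers q := ⟨q, Subgroup.mem_zpowers q⟩
  obtain ⟨ρ, hρ, C, hC, hbound⟩ := σ.exists_norm_coeff_matrix_pow_le b γ
  have hover : ∀ (u : unitDisk K) i j,
      IsOverconvergent (taylorCoeff (fun m => F m i j) (((u : Kˣ) : K) - 1)) := fun u i j => by
    refine (hF.family i j).isOverconvergent_taylorCoeff hp (norm_sub_one_lt q)
      (pow_ne_one_of_unitDisk hq) hρ hC (fun n k => ?_) (norm_sub_one_lt u)
    have h1 := hbound n i j k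
    rw [hF.coeff_matrix hp0 hp] at h1
    simpa using h1
  let A : unitDisk K → Matrix (Fin d) (Fin d) (HDagger K) := fun u i j => ⟨_, hover u i j⟩
  have hA : ∀ (u : unitDisk K) (x : K), ‖x‖ = 1 →
      (A u).map (fun f => laurentEval f.coeff x) = taylorEval F (((u : Kˣ) : K) * x) x :=
    fun u x hx => by
      ext i j
      exact (hF.family i j).laurentEval_taylorCoeff_sub_one u hx
  -- Both Y(ux,y) and Y(ux,x)Y(x,y) are analytic in u, and they agree at u = q^n by the equation
  -- over the powers of q.
  have hrel : ∀ (u : unitDisk K) (x y : K), ‖x‖ = 1 → ‖y‖ = 1 → ‖x - y‖ < 1 →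
      taylorEval F (((u : Kˣ) : K) * x) y =
        (A u).map (fun f => laurentEval f.coeff x) * taylorEval F x y := by
    intro u x y hx hy hxy
    rw [hA u x hx]
    ext i j
    rw [Matrix.mul_apply]
    refine congrFun (eq_of_eq_on_powers hp hq
      (f := fun u => taylorEval F (((u : Kˣ) : K) * x) y i j)
      (g := fun u => ∑ l, taylorEval F (((u : Kˣ) : K) * x) x i l * taylorEval F x y l j)
      ((hF.family i j).isDiscAnalytic hx hy hxy) (IsDiscAnalytic.sum _ fun l _ =>
        ((hF.family i l).isDiscAnalytic hx hx (by simp)).mul (isDiscAnalytic_const _))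
      fun n => ?_) u
    have h1 := hF.equation (γ ^ n) x y hx hy hxy
    rw [hF.eval_matrix _ hx] at h1
    have h2 := congrFun (congrFun h1 i) j
    rw [Matrix.mul_apply] at h2
    exact h2
  have hext : ∀ B B' : Matrix (Fin d) (Fin d) (HDagger K), (∀ x : K, ‖x‖ = 1 →
      B.map (fun f => laurentEval f.coeff x) = B'.map (fun f => laurentEval f.coeff x)) →
      B = B' := fun B B' h => by
    ext1 i j
    exact HDagger.ext_eval hp0 hp fun x hx => congrFun (congrFun (h x hx) i) j
  have hone : A 1 = 1 := hext _ _ fun x hx => by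
    rw [hA 1 x hx]
    have h1 : (1 : Matrix (Fin d) (Fin d) (HDagger K)).map (fun f => laurentEval f.coeff x) = 1 :=
      Matrix.map_one (HDagger.evalHom x hx) (map_zero _) (map_one _)
    rw [h1, OneMemClass.coe_one, Units.val_one, one_mul, hF.diag x hx]
  -- At a point x of the circle this is `hrel` for v at the pair (ux, x): Y(vux,x) = A(v,ux)Y(ux,x).
  have hmul : ∀ u v, A (u * v) = (A v).map (sigmaHom u) * A u := fun u v =>
      hext _ _ fun x hx => by
    have hux := norm_smul_eq_one u hx
    have h1 : ((A v).map (sigmaHom u) * A u).map (fun f => laurentEval f.coeff x) =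
        (A v).map (fun f => laurentEval f.coeff (((u : Kˣ) : K) * x)) *
          (A u).map (fun f => laurentEval f.coeff x) := by
      have := Matrix.map_mul (L := (A v).map (sigmaHom u)) (M := A u)
        (f := HDagger.evalHom x hx)
      refine this.trans (congrArg₂ _ ?_ rfl)
      ext i j
      exact HDagger.evalHom_sigmaHom u x hx _
    rw [h1, hA u x hx, ← hrel v _ x hux hx (norm_mul_sub_lt u hx (by simp)), hA (u * v) x hx,
      Subgroup.coe_mul, Units.val_mul]
    congr 1
    ring
  refine ⟨ofMatrix b A hone hmul, IsTaylorSolution.isSolvable (b := b) (F := F)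
    ⟨hF.family, hF.diag, fun g x y hx hy hxy => ?_⟩, eq_of_matrix_eq b fun g => ?_⟩
  · rw [ofMatrix_matrix]
    exact hrel g x y hx hy hxy
  · have h1 : ((ofMatrix b A hone hmul).res (le_top : Subgroup.zpowers q ≤ ⊤)).matrix b g =
        (ofMatrix b A hone hmul).matrix b (Subgroup.inclusion le_top g) := rfl
    rw [h1, ofMatrix_matrix]
    refine hext _ _ fun x hx => ?_
    rw [hA _ x hx, hF.eval_matrix g hx]
    rfl

end SigmaStructure

end Existence

/-! ### Uniqueness of the extension. -/

section Uniqueness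

variable {p : ℕ} [Fact p.Prime] {K : Type*} [NormedField K] [IsUltrametricDist K]
  [CompleteSpace K] {M : Type*} [AddCommGroup M] [Module (HDagger K) M] {d : ℕ}
  {q : unitDisk K}

namespace SigmaStructure

/-- In the basis of the solution, coefficients of m become f(ux) and the matrix becomes Y(ux,x),
both analytic in u. The functional l is arbitrary so that extensions whose solutions live in
different bases can be compared. -/
theorem IsTaylorSolution.isDiscAnalytic_act {E : SigmaStructure (⊤ : Subgroup (unitDisk K)) M}
    {b : Module.Basis (Fin d) (HDagger K) M} {F : ℕ → Matrix (Fin d) (Fin d) (ℤ → K)}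
    (h : E.IsTaylorSolution b F) (m : M) (l : M →ₗ[HDagger K] HDagger K) {x : K} (hx : ‖x‖ = 1) :
    IsDiscAnalytic fun u : unitDisk K =>
      HDagger.evalHom x hx (l (E.act ⟨u, Subgroup.mem_top u⟩ m)) := by
  have key : ∀ u : unitDisk K, HDagger.evalHom x hx (l (E.act ⟨u, Subgroup.mem_top u⟩ m)) =
      ∑ i, laurentEval (b.repr m i).coeff (((u : Kˣ) : K) * x) *
        ∑ j, taylorValue (fun m => F m i j) (((u : Kˣ) : K) * x) x *
          HDagger.evalHom x hx (l (b j)) := by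
    intro u
    conv_lhs => rw [← b.sum_repr m]
    rw [map_sum, map_sum, map_sum]
    refine Finset.sum_congr rfl fun i _ => ?_
    rw [E.act_smul, map_smul, smul_eq_mul, map_mul, HDagger.evalHom_sigmaHom, E.act_basis b,
      map_sum, map_sum]
    congr 1
    refine Finset.sum_congr rfl fun j _ => ?_
    rw [map_smul, smul_eq_mul, map_mul]
    congr 1
    exact congrFun (congrFun (h.eval_matrix ⟨u, Subgroup.mem_top u⟩ hx) i) j
  simp only [key]
  exact IsDiscAnalytic.sum _ fun i _ =>
    (isDiscAnalytic_laurentEval (HDagger.tendsto_coeff _) hx).mul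
      (IsDiscAnalytic.sum _ fun j _ =>
        ((h.family i j).isDiscAnalytic hx hx (by simp)).mul (isDiscAnalytic_const _))

theorem IsTaylorExtension.act_eq {σ : SigmaStructure (Subgroup.zpowers q) M}
    {E : SigmaStructure (⊤ : Subgroup (unitDisk K)) M} (h : σ.IsTaylorExtension E)
    (g : Subgroup.zpowers q) (m : M) :
    E.act ⟨(g : unitDisk K), Subgroup.mem_top _⟩ m = σ.act g m := by
  rw [← h.2]; rfl

variable [CharZero K]

theorem IsTaylorExtension.unique (hp : ‖(p : K)‖ < 1) (hq : ∀ m : ℕ, 0 < m → q ^ m ≠ 1)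
    {σ : SigmaStructure (Subgroup.zpowers q) M}
    {E E' : SigmaStructure (⊤ : Subgroup (unitDisk K)) M} (h : σ.IsTaylorExtension E)
    (h' : σ.IsTaylorExtension E') : E = E' := by
  have hp0 : (p : K) ≠ 0 := Nat.cast_ne_zero.2 (Fact.out : p.Prime).ne_zero
  obtain ⟨d, b, F, hF⟩ := h.1.exists_solution
  obtain ⟨d', b', F', hF'⟩ := h'.1.exists_solution
  refine eq_of_act_eq fun g m => b.ext_elem fun i => HDagger.ext_eval hp0 hp fun x hx => ?_
  refine congrFun (eq_of_eq_on_powers hp hq (hF.isDiscAnalytic_act m (b.coord i) hx)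
    (hF'.isDiscAnalytic_act m (b.coord i) hx) fun n => ?_) (g : unitDisk K)
  have h1 := h.act_eq ⟨q ^ n, Subgroup.npow_mem_zpowers q n⟩ m
  have h2 := h'.act_eq ⟨q ^ n, Subgroup.npow_mem_zpowers q n⟩ m
  rw [h1, h2]

end SigmaStructure

end Uniqueness

/-! ### Frobenius on values of Laurent series. -/

section FrobeniusEvaluation

variable {p : ℕ} [Fact p.Prime] {K : Type*} [NormedField K] [IsUltrametricDist K]

/-- Only exponents divisible by p contribute. The extra homomorphism ψ is there for the induction on
iterates of Frobenius. -/
theorem AbsoluteFrobenius.laurentEval_twist (φ : AbsoluteFrobenius p K) (hp0 : (p : K) ≠ 0)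
    (ψ : K →+* K) (a : ℤ → K) (x : K) :
    laurentEval (fun k => ψ (φ.twist a k)) x =
      laurentEval (fun k => ψ (φ.toRingHom (a k))) (x ^ p) := by
  have hp : (p : ℤ) ≠ 0 := by exact_mod_cast (Fact.out : p.Prime).ne_zero
  have hinj : Function.Injective fun j : ℤ => (p : ℤ) * j := mul_right_injective₀ hp
  unfold laurentEval
  rw [← hinj.tsum_eq (f := fun k => ψ (φ.twist a k) * x ^ k)]
  · exact tsum_congr fun j => by rw [φ.twist_mul hp0, zpow_mul, zpow_natCast]
  · intro k hk
    by_contra hni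
    apply hk
    have : ¬ (p : ℤ) ∣ k := fun ⟨j, hj⟩ => hni ⟨j, hj.symm⟩
    simp only [φ.twist_of_not_dvd a this, map_zero, zero_mul]

variable [CompleteSpace K] [CharZero K]

theorem AbsoluteFrobenius.laurentEval_onHDagger_pow (φ : AbsoluteFrobenius p K)
    (hp : ‖(p : K)‖ < 1) (h : ℕ) : ∀ (f : HDagger K) (x : K),
    laurentEval ((φ.onHDagger hp ^ h) f).coeff x =
      laurentEval (fun k => (φ.toRingHom ^ h) (f.coeff k)) (x ^ p ^ h) := by
  have hp0 : (p : K) ≠ 0 := Nat.cast_ne_zero.2 (Fact.out : p.Prime).ne_zero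
  induction h with
  | zero => intro f x; simp
  | succ h ih =>
    intro f x
    rw [pow_succ, RingHom.mul_def, RingHom.comp_apply, ih]
    have := φ.laurentEval_twist hp0 (φ.toRingHom ^ h) f.coeff (x ^ p ^ h)
    rw [← pow_mul, ← pow_succ] at this
    exact this

theorem AbsoluteFrobenius.norm_pow_le (φ : AbsoluteFrobenius p K) (hp : ‖(p : K)‖ < 1) (h : ℕ)
    (x : K) : ‖(φ.toRingHom ^ h) x‖ ≤ ‖x‖ := by
  have hp0 : (p : K) ≠ 0 := Nat.cast_ne_zero.2 (Fact.out : p.Prime).ne_zero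
  induction h with
  | zero => simp
  | succ h ih =>
    rw [pow_succ', RingHom.mul_def, RingHom.comp_apply]
    exact (φ.norm_le hp0 hp _).trans ih

/-- Frobenius turns the factor u^k of the k-th coefficient into φ^h(u)^k = v^{p^h k}, which is what
x ↦ vx does to (x^{p^h})^k. -/
theorem AbsoluteFrobenius.laurentEval_onHDagger_pow_sigmaHom (φ : AbsoluteFrobenius p K)
    (hp : ‖(p : K)‖ < 1) {h : ℕ} {u v : unitDisk K}
    (huv : (φ.toRingHom ^ h) ((u : Kˣ) : K) = ((v : Kˣ) : K) ^ p ^ h) (f : HDagger K) (x : K) :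
    laurentEval ((φ.onHDagger hp ^ h) (sigmaHom u f)).coeff x =
      laurentEval ((φ.onHDagger hp ^ h) f).coeff (((v : Kˣ) : K) * x) := by
  rw [φ.laurentEval_onHDagger_pow, φ.laurentEval_onHDagger_pow]
  unfold laurentEval
  refine tsum_congr fun k => ?_
  beta_reduce
  rw [coeff_sigmaHom, map_mul, map_zpow₀, huv, mul_pow, mul_zpow]
  ring

end FrobeniusEvaluation

/-! ### Frobenius structures and roots of unity. -/

section FrobeniusStructure

variable {p : ℕ} [Fact p.Prime] {K : Type*} [NormedField K] [IsUltrametricDist K]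
  [CompleteSpace K] [CharZero K] {M : Type*} [AddCommGroup M] [Module (HDagger K) M] {d : ℕ}
  {q : unitDisk K}

instance : Nontrivial (HDagger K) :=
  ⟨⟨1, 0, fun h => one_ne_zero (α := K) (by
    simpa [HDagger.coeff_one, HDagger.coeff_zero] using congrArg (fun f => f.coeff 0) h)⟩⟩

namespace SigmaStructure

/-- A Frobenius commutes with the operators of the Taylor extension at all corresponding points of
the disc. -/
theorem frobenius_act (hp : ‖(p : K)‖ < 1) (φ : AbsoluteFrobenius p K)
    (hq : ∀ m : ℕ, 0 < m → q ^ m ≠ 1) {E : SigmaStructure (⊤ : Subgroup (unitDisk K)) M}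
    (hE : E.IsSolvable) {h : ℕ} {q' : unitDisk K}
    (hqq : (φ.toRingHom ^ h) ((q' : Kˣ) : K) = ((q : Kˣ) : K) ^ p ^ h)
    (Φ : M →ₛₗ[φ.onHDagger hp ^ h] M)
    (hΦ : ∀ m, Φ (E.act ⟨q', Subgroup.mem_top q'⟩ m) = E.act ⟨q, Subgroup.mem_top q⟩ (Φ m))
    {u v : unitDisk K} (huv : (φ.toRingHom ^ h) ((u : Kˣ) : K) = ((v : Kˣ) : K) ^ p ^ h) (m : M) :
    Φ (E.act ⟨u, Subgroup.mem_top u⟩ m) = E.act ⟨v, Subgroup.mem_top v⟩ (Φ m) := by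
  have hp0 : (p : K) ≠ 0 := Nat.cast_ne_zero.2 (Fact.out : p.Prime).ne_zero
  obtain ⟨d, b, F, hF⟩ := hE.exists_solution
  refine b.ext_elem fun t => HDagger.ext_eval hp0 hp fun x hx => ?_
  have hψ := φ.norm_pow_le hp h
  have hxP : ‖x ^ p ^ h‖ = 1 := by rw [norm_pow, hx, one_pow]
  -- The value of Φσ_u(m) involves u only through φ^h(u) = v^{p^h}. Writing it in terms of v gives a
  -- function analytic on the whole disc, even where no u corresponds to v.
  let W : unitDisk K → K := fun v =>
    ∑ i, laurentEval ((φ.onHDagger hp ^ h) (b.repr m i)).coeff (((v : Kˣ) : K) * x) *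
      ∑ j, taylorValue (fun m k => (φ.toRingHom ^ h) (F m i j k)) ((((v : Kˣ) : K) * x) ^ p ^ h)
        (x ^ p ^ h) * HDagger.evalHom x hx (b.coord t (Φ (b j)))
  have hW : IsDiscAnalytic W := IsDiscAnalytic.sum _ fun i _ =>
    (isDiscAnalytic_laurentEval (HDagger.tendsto_coeff _) hx).mul
      (IsDiscAnalytic.sum _ fun j _ =>
        (((hF.family i j).map _ hψ).isDiscAnalytic_pow hx _).mul (isDiscAnalytic_const _))
  have key : ∀ u v : unitDisk K, (φ.toRingHom ^ h) ((u : Kˣ) : K) = ((v : Kˣ) : K) ^ p ^ h →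
      HDagger.evalHom x hx (b.coord t (Φ (E.act ⟨u, Subgroup.mem_top u⟩ m))) = W v := by
    intro u v huv
    conv_lhs => rw [← b.sum_repr m]
    rw [map_sum, map_sum, map_sum, map_sum]
    refine Finset.sum_congr rfl fun i _ => ?_
    rw [E.act_smul, Φ.map_smulₛₗ, map_smul, smul_eq_mul, map_mul, E.act_basis b, map_sum, map_sum,
      map_sum]
    congr 1
    · exact φ.laurentEval_onHDagger_pow_sigmaHom hp huv _ x
    refine Finset.sum_congr rfl fun j _ => ?_
    rw [Φ.map_smulₛₗ, map_smul, smul_eq_mul, map_mul]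
    congr 1
    rw [HDagger.evalHom_apply, φ.laurentEval_onHDagger_pow, hF.coeff_matrix hp0 hp]
    simp only [(hF.family i j).map_taylorCoeff _ hψ (norm_sub_one_lt _), map_sub, map_one, huv]
    have h1 := ((hF.family i j).map _ hψ).laurentEval_taylorCoeff_sub_one (v ^ p ^ h) hxP
    rw [coe_pow_unitDisk, ← mul_pow] at h1
    exact h1
  have hpow : ∀ n : ℕ, Φ (E.act ⟨q' ^ n, Subgroup.mem_top _⟩ m) =
      E.act ⟨q ^ n, Subgroup.mem_top _⟩ (Φ m) := by
    intro n
    have hqn : ∀ w : unitDisk K, (⟨w ^ n, Subgroup.mem_top _⟩ : (⊤ : Subgroup (unitDisk K))) =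
        ⟨w, Subgroup.mem_top _⟩ ^ n := fun w => rfl
    rw [hqn, hqn, map_pow, map_pow]
    induction n with
    | zero => simp
    | succ n ih =>
      rw [pow_succ', pow_succ']
      change Φ (E.act ⟨q', _⟩ ((E.act ⟨q', _⟩ ^ n) m)) = E.act ⟨q, _⟩ ((E.act ⟨q, _⟩ ^ n) (Φ m))
      rw [hΦ, ih fun w => rfl]
  -- W and the coordinate of σ_v(Φ(m)) agree at v = q^n, with u = q'^n as the corresponding point,
  -- hence for all v.
  refine (key u v huv).trans (congrFun (eq_of_eq_on_powers hp hq hW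
    (hF.isDiscAnalytic_act (Φ m) (b.coord t) hx) fun n => ?_) v)
  rw [← hpow n]
  refine (key (q' ^ n) (q ^ n) ?_).symm
  rw [coe_pow_unitDisk, coe_pow_unitDisk, map_pow, hqq, ← pow_mul, ← pow_mul, mul_comm]

/-- Descent along p-th powers; it places the preimages under Frobenius in the disc. -/
theorem norm_sub_one_lt_of_pow_eq_one (hp : ‖(p : K)‖ < 1) (n : ℕ) {x : K} (h : x ^ p ^ n = 1) :
    ‖x - 1‖ < 1 := by
  induction n generalizing x with
  | zero => rw [pow_zero, pow_one] at h; simp [h]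
  | succ n ih =>
    rw [pow_succ', pow_mul] at h
    have h1 := ih h
    refine norm_sub_one_lt_of_pow hp ?_ h1
    have h2 : ‖x‖ ^ p * 1 ≤ 1 := by
      have h3 := congrArg norm h
      rw [norm_pow, norm_pow, norm_one] at h3
      rw [mul_one, pow_eq_one_iff_of_nonneg (by positivity)
        (pow_ne_zero _ (Fact.out : p.Prime).ne_zero) |>.1 h3]
    rw [mul_one] at h2
    exact (pow_le_one_iff_of_nonneg (norm_nonneg _) (Fact.out : p.Prime).ne_zero).1 h2

/-- A power of Frobenius permutes the roots of unity of order dividing `p ^ n`. -/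
theorem exists_frobenius_preimage (hp : ‖(p : K)‖ < 1) (φ : AbsoluteFrobenius p K) {h n : ℕ}
    (hh : 1 ≤ h) {ξ : unitDisk K} (hξ : ξ ^ p ^ (n + 1) = 1) :
    ∃ ζ : unitDisk K, ζ ^ p ^ n = 1 ∧
      (φ.toRingHom ^ h) ((ζ : Kˣ) : K) = ((ξ : Kˣ) : K) ^ p ^ h := by
  have hpn : 0 < p ^ n := pow_pos (Fact.out : p.Prime).pos n
  have hmaps : Set.MapsTo (φ.toRingHom ^ h) (Polynomial.nthRootsFinset (p ^ n) (1 : K) : Set K)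
      (Polynomial.nthRootsFinset (p ^ n) (1 : K) : Set K) := by
    intro x hx
    rw [Finset.mem_coe, Polynomial.mem_nthRootsFinset hpn] at hx ⊢
    rw [← map_pow, hx, map_one]
  -- A field endomorphism is injective, hence surjective on the finite set of p^n-th roots of unity
  -- in K.
  have hsurj := Finset.surjOn_of_injOn_of_card_le _ hmaps
    (φ.toRingHom ^ h).injective.injOn le_rfl
  have hξK : ((ξ : Kˣ) : K) ^ p ^ (n + 1) = 1 := by
    rw [← coe_pow_unitDisk, hξ]; simp
  -- Here h ≥ 1 is essential: raising to the power p^h removes at least one factor p from the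
  -- exponent p^{n+1}.
  have hmem : ((ξ : Kˣ) : K) ^ p ^ h ∈ (Polynomial.nthRootsFinset (p ^ n) (1 : K) : Set K) := by
    rw [Finset.mem_coe, Polynomial.mem_nthRootsFinset hpn, ← pow_mul, ← pow_add]
    obtain ⟨l, rfl⟩ := Nat.exists_eq_add_of_le hh
    rw [show 1 + l + n = (n + 1) + l by ring, pow_add, pow_mul, hξK, one_pow]
  obtain ⟨z, hz, hzξ⟩ := hsurj hmem
  rw [Finset.mem_coe, Polynomial.mem_nthRootsFinset hpn] at hz
  have hz0 : z ≠ 0 := by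
    rintro rfl
    rw [zero_pow hpn.ne'] at hz
    exact zero_ne_one hz
  refine ⟨⟨Units.mk0 z hz0, norm_sub_one_lt_of_pow_eq_one hp n hz⟩, ?_, hzξ⟩
  exact Subtype.ext (Units.ext (by rw [coe_pow_unitDisk]; simpa using hz))

/-- The iterates of a semilinear map that sends a basis to a basis do the same. -/
theorem span_iterate_eq_top {R N : Type*} [CommRing R] [AddCommGroup N] [Module R N] {τ : R →+* R}
    (Φ : N →ₛₗ[τ] N) {b b' : Module.Basis (Fin d) R N} (hb : ∀ i, Φ (b i) = b' i) (n : ℕ) :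
    Submodule.span R (Set.range fun i => Φ^[n] (b i)) = ⊤ := by
  induction n with
  | zero => exact b.span_eq
  | succ n ih =>
    -- Surjectivity of Φ or τ is not needed: the image of Φ lies in this span, and it contains the
    -- basis b'.
    have hΦ : ∀ y, Φ y ∈ Submodule.span R (Set.range fun i => Φ^[n + 1] (b i)) := by
      intro y
      have hy : y ∈ Submodule.span R (Set.range fun i => Φ^[n] (b i)) := ih ▸ Submodule.mem_top
      induction hy using Submodule.span_induction with
      | mem y hy =>
        obtain ⟨i, rfl⟩ := hy
        refine Submodule.subset_span ⟨i, ?_⟩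
        exact Function.iterate_succ_apply' Φ n (b i)
      | zero => rw [map_zero]; exact Submodule.zero_mem _
      | add y z _ _ hy hz => rw [map_add]; exact Submodule.add_mem _ hy hz
      | smul c y _ hy => rw [Φ.map_smulₛₗ]; exact Submodule.smul_mem _ _ hy
    rw [eq_top_iff, ← b'.span_eq, Submodule.span_le]
    rintro _ ⟨i, rfl⟩
    rw [← hb]
    exact hΦ _

theorem isTrivial_of_basis {G : Subgroup (unitDisk K)} (D : SigmaStructure G M)
    (b : Module.Basis (Fin d) (HDagger K) M) (h : ∀ g i, D.act g (b i) = b i) : D.IsTrivial := by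
  refine ⟨d, b.equivFun, fun g m i => ?_⟩
  conv_lhs => rw [← b.sum_repr m, map_sum]
  simp only [D.act_smul, h]
  rw [← Module.Basis.equivFun_symm_apply, LinearEquiv.apply_symm_apply]
  rfl

theorem isTrivial_of_hasFrobeniusStructure (hp : ‖(p : K)‖ < 1) (φ : AbsoluteFrobenius p K)
    (hq : ∀ m : ℕ, 0 < m → q ^ m ≠ 1) {σ : SigmaStructure (Subgroup.zpowers q) M}
    (hσ : σ.HasFrobeniusStructure φ hp) {n : ℕ} {ξ : unitDisk K} (hξ : ξ ^ p ^ n = 1)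
    {D : SigmaStructure (Subgroup.zpowers ξ) M} (hD : σ.IsTaylorDeformation D) : D.IsTrivial := by
  obtain ⟨h, hh, E, hE, q', hqq, Φ, ⟨d, b, b', hb⟩, hΦ⟩ := hσ
  obtain ⟨E', hE', rfl⟩ := hD
  -- The Frobenius structure and the deformation each come with an extension; uniqueness identifies
  -- them.
  obtain rfl := hE.unique hp hq hE'
  rw [← RingHom.coe_pow] at hqq
  have hΦ' : ∀ m, Φ (E.act ⟨q', Subgroup.mem_top q'⟩ m) =
      E.act ⟨q, Subgroup.mem_top q⟩ (Φ m) := fun m => by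
    rw [hΦ, ← hE.act_eq ⟨q, Subgroup.mem_zpowers q⟩]
  -- In the inductive step σ_ζΦ^{n+1} = Φσ_{ζ'}Φ^n = Φ^{n+1}, where ζ' has exponent p^n and
  -- corresponds to ζ under Frobenius.
  have hfix : ∀ (n : ℕ) (ζ : unitDisk K), ζ ^ p ^ n = 1 → ∀ m,
      E.act ⟨ζ, Subgroup.mem_top ζ⟩ (Φ^[n] m) = Φ^[n] m := by
    intro n
    induction n with
    | zero =>
      intro ζ hζ m
      rw [pow_zero, pow_one] at hζ
      subst hζ
      have : (⟨1, Subgroup.mem_top _⟩ : (⊤ : Subgroup (unitDisk K))) = 1 := rfl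
      rw [this, map_one]
      rfl
    | succ n ih =>
      intro ζ hζ m
      obtain ⟨ζ', hζ', hζζ⟩ := exists_frobenius_preimage hp φ hh hζ
      rw [Function.iterate_succ_apply', ← frobenius_act hp φ hq hE.1 hqq Φ hΦ' hζζ, ih ζ' hζ']
  have hspan := span_iterate_eq_top Φ hb n
  -- A spanning family with as many members as the rank is a basis.
  have hli := linearIndependent_of_top_le_span_of_card_eq_finrank hspan.ge
    (Module.finrank_eq_card_basis b).symm
  refine isTrivial_of_basis _ (Module.Basis.mk hli hspan.ge) fun g i => ?_
  rw [Module.Basis.mk_apply]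
  refine hfix n g ?_ (b i)
  obtain ⟨k, hk⟩ := Subgroup.mem_zpowers_iff.1 g.2
  rw [← hk, ← zpow_natCast, ← zpow_mul, mul_comm, zpow_mul, zpow_natCast, hξ, one_zpow]

end SigmaStructure

end FrobeniusStructure

theorem mainTheorem12 {p : ℕ} [Fact p.Prime] {K : Type*} [NormedField K] [IsUltrametricDist K]
    [CompleteSpace K] [CharZero K] (hp : ‖(p : K)‖ < 1) (φ : AbsoluteFrobenius p K)
    (q : unitDisk K) (hq : ∀ m : ℕ, 0 < m → q ^ m ≠ 1)
    {M : Type*} [AddCommGroup M] [Module (HDagger K) M] [Module.Free (HDagger K) M]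
    [Module.Finite (HDagger K) M]
    (σ : SigmaStructure (Subgroup.zpowers q) M) (hσ : σ.IsSolvable) :
    (∃! E : SigmaStructure (⊤ : Subgroup (unitDisk K)) M, σ.IsTaylorExtension E) ∧
    (σ.HasFrobeniusStructure φ hp →
      ∀ (n : ℕ) (ξ : unitDisk K), ξ ^ p ^ n = 1 →
        ∀ D : SigmaStructure (Subgroup.zpowers ξ) M, σ.IsTaylorDeformation D → D.IsTrivial) := by
  obtain ⟨E, hE⟩ := SigmaStructure.exists_isTaylorExtension hp hq σ hσ
  exact ⟨⟨E, hE, fun E' hE' => hE'.unique hp hq hE⟩, fun hF n ξ hξ D hD =>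
    SigmaStructure.isTrivial_of_hasFrobeniusStructure hp φ hq hF hξ hD⟩
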